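/- Let $B\subset\mathbb R^3$ be a bounded open set with boundary $\Gamma=\partial B$ and unit outward normal $\boldsymbol n$, let $\alpha>0$, $0<\mu_r<\infty$, $\omega,\sigma_*\in\mathbb R$, $\mu_0=4\pi\times10^{-7}$ and $\nu=\alpha^2\omega\mu_0\sigma_*$. Put $B^c=\mathbb R^3\setminus B$, $\tilde\mu_r=\mu_r$ in $B$ and $\tilde\mu_r=1$ in $B^c$, let $[\cdot]_\Gamma$ denote the jump across $\Gamma$, and let $\boldsymbol e_1,\boldsymbol e_2,\boldsymbol e_3$ be the standard basis. For $i=1,2,3$ let $\boldsymbol\theta_i^{(0)}$ (real-valued) and $\boldsymbol\theta_i^{(1)}$ (complex-valued) be weak solutions, of class $\boldsymbol H_{\rm loc}(\mathrm{curl})$ on $\mathbb R^3$, of the transmission problems $$\nabla\times\tilde\mu_r^{-1}\nabla\times\boldsymbol\theta_i^{(0)}=\boldsymbol 0,\quad \nabla\cdot\boldsymbol\theta_i^{(0)}=0\ \text{ in } B\cup B^c \text{ (off } \Gamma),\qquad [\boldsymbol n\times\boldsymbol\theta_i^{(0)}]_\Gamma=[\boldsymbol n\times\tilde\mu_r^{-1}\nabla\times\boldsymbol\theta_i^{(0)}]_\Gamma=\boldsymbol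 0,\qquad \boldsymbol\theta_i^{(0)}-\boldsymbol e_i\times\boldsymbol\xi=\boldsymbol O(|\boldsymbol\xi|^{-1})\ \ (|\boldsymbol\xi|\to\infty),$$ $$\nabla\times\mu_r^{-1}\nabla\times\boldsymbol\theta_i^{(1)}-\mathrm i\nu(\boldsymbol\theta_i^{(0)}+\boldsymbol\theta_i^{(1)})=\boldsymbol 0\ \text{ in } B,\qquad \nabla\times\nabla\times\boldsymbol\theta_i^{(1)}=\boldsymbol 0,\quad \nabla\cdot\boldsymbol\theta_i^{(1)}=0\ \text{ in } B^c \text{ (off } \Gamma),$$ $$[\boldsymbol n\times\boldsymbol\theta_i^{(1)}]_\Gamma=[\boldsymbol n\times\tilde\mu_r^{-1}\nabla\times\boldsymbol\theta_i^{(1)}]_\Gamma=\boldsymbol 0,\qquad \boldsymbol\theta_i^{(1)}=\boldsymbol O(|\boldsymbol\xi|^{-1})\ \ (|\boldsymbol\xi|\to\infty).$$ Here the curl-curl equations together with the jump conditions are understood variationally: for all compactly supported $\boldsymbol\psi\in\boldsymbol H(\mathrm{curl})$ (real-valued in the first identity, complex-valued in the second), $$\int_{\mathbb R^3}\tilde\mu_r^{-1}\,\nabla\times\boldsymbol\theta_i^{(0)}\cdot\nabla\times\boldsymbol\psi\,d\boldsymbol\xi=0,\qquad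 \int_{\mathbb R^3}\tilde\mu_r^{-1}\,\nabla\times\boldsymbol\theta_i^{(1)}\cdot\nabla\times\overline{\boldsymbol\psi}\,d\boldsymbol\xi-\mathrm i\nu\int_B(\boldsymbol\theta_i^{(0)}+\boldsymbol\theta_i^{(1)})\cdot\overline{\boldsymbol\psi}\,d\boldsymbol\xi=0,$$ and the divergence conditions are understood in the sense of distributions. With $\tilde{\boldsymbol\theta}_i^{(0)}=\boldsymbol\theta_i^{(0)}-\boldsymbol e_i\times\boldsymbol\xi$, a magnetic polarizability tensor (MPT) $\mathcal M[\alpha B,\omega,\mu_r,\sigma_*]=\mathcal N^0+\mathcal R+\mathrm i\,\mathcal I$ of the object $\alpha B$ is the tensor with coefficients computed from such solutions by $$(\mathcal N^0)_{ij}=\alpha^3\delta_{ij}\int_B(1-\mu_r^{-1})\,d\boldsymbol\xi+\frac{\alpha^3}{4}\int_{\mathbb R^3}\tilde\mu_r^{-1}\,\nabla\times\tilde{\boldsymbol\theta}_i^{(0)}\cdot\nabla\times\tilde{\boldsymbol\theta}_j^{(0)}\,d\boldsymbol\xi,\qquad (\mathcal R)_{ij}=-\frac{\alpha^3}{4}\int_{\mathbb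 R^3}\tilde\mu_r^{-1}\,\nabla\times\boldsymbol\theta_j^{(1)}\cdot\nabla\times\overline{\boldsymbol\theta_i^{(1)}}\,d\boldsymbol\xi,$$ $$(\mathcal I)_{ij}=\frac{\alpha^3}{4}\int_B\nu\,\bigl(\boldsymbol\theta_j^{(1)}+\tilde{\boldsymbol\theta}_j^{(0)}+\boldsymbol e_j\times\boldsymbol\xi\bigr)\cdot\overline{\bigl(\boldsymbol\theta_i^{(1)}+\tilde{\boldsymbol\theta}_i^{(0)}+\boldsymbol e_i\times\boldsymbol\xi\bigr)}\,d\boldsymbol\xi .$$ Let $s>0$. Then $$(\mathcal M[s\alpha B,\omega,\mu_r,\sigma_*])_{ij}=s^3\,(\mathcal M[\alpha B,s^2\omega,\mu_r,\sigma_*])_{ij}\qquad(i,j=1,2,3).$$ This holds however the object $s\alpha B$ is presented as $\alpha' B'$ with a size $\alpha'>0$ and a shape $B'$ (for example $\alpha'=s\alpha$, $B'=B$, or $\alpha'=\alpha$, $B'=sB$), and for every choice of solutions of the transmission problems on the two sides. Moreover a tensor $\mathcal M$ is an MPT of $\alpha B$ at frequency $s^2\omega$ if and only if $s^3\mathcal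 M$ is an MPT of $\alpha'B'$ at frequency $\omega$. -/

import Mathlib

open MeasureTheory
open scoped Pointwise

noncomputable section

namespace MPT

/-- Three-dimensional Euclidean space, over `ℝ` (points, real vectors) or `ℂ` (complex vectors). -/
abbrev V3 (𝕜 : Type*) := EuclideanSpace 𝕜 (Fin 3)

/-- The unit vector `e_i`. -/
def e (i : Fin 3) : V3 ℝ := EuclideanSpace.single i 1

/-- The vector field `ξ ↦ e_i × ξ`. -/
def eCross (i : Fin 3) (ξ : V3 ℝ) : V3 ℝ :=
  WithLp.toLp 2 (crossProduct (WithLp.ofLp (e i)) (WithLp.ofLp ξ))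

/-- A real vector regarded as a complex one. -/
def toC (v : V3 ℝ) : V3 ℂ := WithLp.toLp 2 fun k => (v k : ℂ)

/-! ### Curl and divergence in the weak sense -/

/-- The classical curl: `(∇ × φ)_k = ∂_{k+1} φ_{k+2} - ∂_{k+2} φ_{k+1}`, indices modulo `3`. -/
def curl (φ : V3 ℝ → V3 ℝ) (x : V3 ℝ) : V3 ℝ :=
  WithLp.toLp 2 fun k : Fin 3 =>
    fderiv ℝ φ x (e (k + 1)) (k + 2) - fderiv ℝ φ x (e (k + 2)) (k + 1)

/-- Locally square integrable vector fields on `ℝ³`. -/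
def MemL2Loc {𝕜 : Type*} [RCLike 𝕜] (u : V3 ℝ → V3 𝕜) : Prop :=
  ∀ K : Set (V3 ℝ), IsCompact K → MemLp u 2 (volume.restrict K)

/-- `v` is a weak curl of `u` on `ℝ³`: `∫ u · (∇ × φ) = ∫ v · φ` for all smooth compactly supported
vector fields `φ`. -/
def IsWeakCurl {𝕜 : Type*} [RCLike 𝕜] (u v : V3 ℝ → V3 𝕜) : Prop :=
  ∀ φ : V3 ℝ → V3 ℝ, ContDiff ℝ (⊤ : ℕ∞) φ → HasCompactSupport φ →
    ∫ x, ∑ k, (curl φ x k) • (u x k) = ∫ x, ∑ k, (φ x k) • (v x k)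

/-- The space `H_loc(curl)` on `ℝ³`. A field which is of this class on either side of a surface `Γ`
belongs to it exactly when its tangential trace `n × u` does not jump across `Γ`. -/
def MemHCurlLoc {𝕜 : Type*} [RCLike 𝕜] (u : V3 ℝ → V3 𝕜) : Prop :=
  MemL2Loc u ∧ ∃ v : V3 ℝ → V3 𝕜, MemL2Loc v ∧ IsWeakCurl u v

open Classical in
/-- The weak curl of a field of class `H_loc(curl)`; it is unique up to null sets. -/
def weakCurl {𝕜 : Type*} [RCLike 𝕜] (u : V3 ℝ → V3 𝕜) : V3 ℝ → V3 𝕜 :=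
  if h : ∃ v : V3 ℝ → V3 𝕜, MemL2Loc v ∧ IsWeakCurl u v then h.choose else 0

/-- `∇ · u = 0` in the open set `U`, in the sense of distributions. -/
def IsDivFreeOn {𝕜 : Type*} [RCLike 𝕜] (u : V3 ℝ → V3 𝕜) (U : Set (V3 ℝ)) : Prop :=
  ∀ φ : V3 ℝ → ℝ, ContDiff ℝ (⊤ : ℕ∞) φ → HasCompactSupport φ → tsupport φ ⊆ U →
    ∫ x, ∑ k, (fderiv ℝ φ x (e k)) • (u x k) = 0

/-- `u(ξ) = O(|ξ|⁻¹)` as `|ξ| → ∞`. -/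
def DecaysAtInfinity {𝕜 : Type*} [RCLike 𝕜] (u : V3 ℝ → V3 𝕜) : Prop :=
  ∃ C R : ℝ, ∀ᵐ ξ : V3 ℝ, R ≤ ‖ξ‖ → ‖u ξ‖ ≤ C * ‖ξ‖⁻¹

/-! ### The transmission problems -/

/-- The vacuum permeability. -/
def mu0 : ℝ := 4 * Real.pi * (10 : ℝ) ^ (-7 : ℤ)

/-- `ν = α² ω μ₀ σ_*`. -/
def nu (α ω σ : ℝ) : ℝ := α ^ 2 * ω * mu0 * σ

open Classical in
/-- The relative permeability: `μ_r` in `B` and `1` outside `B`. -/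
def muTilde (B : Set (V3 ℝ)) (μr : ℝ) (ξ : V3 ℝ) : ℝ := if ξ ∈ B then μr else 1

/-- `θ` is a weak solution `θ_i^{(0)}` of
`∇ × μ̃_r⁻¹ ∇ × θ = 0` and `∇ · θ = 0` in `B ∪ Bᶜ`,
`[n × θ] = 0` and `[n × μ̃_r⁻¹ ∇ × θ] = 0` on `∂B`, `θ - e_i × ξ = O(|ξ|⁻¹)`.
The jump condition on `n × θ` is `θ ∈ H_loc(curl)`; the curl-curl equation off `∂B` together with
the jump condition on `n × μ̃_r⁻¹ ∇ × θ` is the variational equation, tested with all compactly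
supported fields `ψ` of class `H(curl)`. -/
structure IsTheta0 (B : Set (V3 ℝ)) (μr : ℝ) (i : Fin 3) (θ : V3 ℝ → V3 ℝ) : Prop where
  memHCurlLoc : MemHCurlLoc θ
  weak_eq : ∀ ψ : V3 ℝ → V3 ℝ, MemHCurlLoc ψ → HasCompactSupport ψ →
    ∫ ξ, (muTilde B μr ξ)⁻¹ * inner ℝ (weakCurl ψ ξ) (weakCurl θ ξ) = 0
  div_free : IsDivFreeOn θ (frontier B)ᶜ
  decay : DecaysAtInfinity fun ξ => θ ξ - eCross i ξ

/-- `θ` is a weak solution `θ_i^{(1)}` (for the given `θ_i^{(0)} = θ0`) of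
`∇ × μ_r⁻¹ ∇ × θ - i ν (θ0 + θ) = 0` in `B`, `∇ × ∇ × θ = 0` and `∇ · θ = 0` in `Bᶜ`,
`[n × θ] = 0` and `[n × μ̃_r⁻¹ ∇ × θ] = 0` on `∂B`, `θ = O(|ξ|⁻¹)`. -/
structure IsTheta1 (B : Set (V3 ℝ)) (μr ν : ℝ) (θ0 : V3 ℝ → V3 ℝ) (θ : V3 ℝ → V3 ℂ) : Prop where
  memHCurlLoc : MemHCurlLoc θ
  weak_eq : ∀ ψ : V3 ℝ → V3 ℂ, MemHCurlLoc ψ → HasCompactSupport ψ →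
    (∫ ξ, (((muTilde B μr ξ)⁻¹ : ℝ) : ℂ) * inner ℂ (weakCurl ψ ξ) (weakCurl θ ξ)) -
      Complex.I * (ν : ℂ) * ∫ ξ in B, inner ℂ (ψ ξ) (toC (θ0 ξ) + θ ξ) = 0
  div_free : IsDivFreeOn θ (closure B)ᶜ
  decay : DecaysAtInfinity θ

/-! ### The magnetic polarizability tensor -/

/-- `θ̃_i^{(0)} = θ_i^{(0)} - e_i × ξ`. -/
def thetaTilde (θ0 : Fin 3 → V3 ℝ → V3 ℝ) (i : Fin 3) (ξ : V3 ℝ) : V3 ℝ := θ0 i ξ - eCross i ξ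

/-- The coefficients of `𝓝⁰[αB]`. -/
def tensorN0 (α : ℝ) (B : Set (V3 ℝ)) (μr : ℝ) (θ0 : Fin 3 → V3 ℝ → V3 ℝ) (i j : Fin 3) : ℝ :=
  α ^ 3 * (if i = j then 1 else 0) * (∫ _ξ in B, (1 - μr⁻¹)) +
    α ^ 3 / 4 * ∫ ξ, (muTilde B μr ξ)⁻¹ *
      inner ℝ (weakCurl (thetaTilde θ0 i) ξ) (weakCurl (thetaTilde θ0 j) ξ)

/-- The coefficients of `𝓡[αB, ω]`; `inner ℂ a b` is `b · conj a`. -/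
def tensorR (α : ℝ) (B : Set (V3 ℝ)) (μr : ℝ) (θ1 : Fin 3 → V3 ℝ → V3 ℂ) (i j : Fin 3) : ℂ :=
  -((α : ℂ) ^ 3 / 4) * ∫ ξ, (((muTilde B μr ξ)⁻¹ : ℝ) : ℂ) *
    inner ℂ (weakCurl (θ1 i) ξ) (weakCurl (θ1 j) ξ)

/-- The coefficients of `𝓘[αB, ω]`. -/
def tensorI (α : ℝ) (B : Set (V3 ℝ)) (ν : ℝ) (θ0 : Fin 3 → V3 ℝ → V3 ℝ)
    (θ1 : Fin 3 → V3 ℝ → V3 ℂ) (i j : Fin 3) : ℂ :=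
  (α : ℂ) ^ 3 / 4 * ∫ ξ in B, (ν : ℂ) *
    inner ℂ (θ1 i ξ + toC (thetaTilde θ0 i ξ + eCross i ξ))
      (θ1 j ξ + toC (thetaTilde θ0 j ξ + eCross j ξ))

/-- `M` is the magnetic polarizability tensor `𝓜[αB, ω, μ_r, σ_*] = 𝓝⁰ + 𝓡 + i 𝓘`, computed from
solutions of the transmission problems for `B`. -/
def IsMPT (α : ℝ) (B : Set (V3 ℝ)) (ω μr σ : ℝ) (M : Matrix (Fin 3) (Fin 3) ℂ) : Prop :=
  ∃ (θ0 : Fin 3 → V3 ℝ → V3 ℝ) (θ1 : Fin 3 → V3 ℝ → V3 ℂ),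
    (∀ i, IsTheta0 B μr i (θ0 i)) ∧
    (∀ i, IsTheta1 B μr (nu α ω σ) (θ0 i) (θ1 i)) ∧
    ∀ i j, M i j = (tensorN0 α B μr θ0 i j : ℂ) + tensorR α B μr θ1 i j +
      Complex.I * tensorI α B (nu α ω σ) θ0 θ1 i j

end MPT

end

noncomputable section

namespace MPT

variable {𝕜 : Type*} [RCLike 𝕜]

/-! ### Locally square integrable fields -/

/-! The proof combines a change of variables with a uniqueness argument. Scaling: the dilation
`dilate t`, `u ↦ t u(·/t)`, fixes `e_i × ξ`, and `∇ × dilate t u = (∇ × u)(·/t)`. It therefore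
carries solutions for `B` to solutions for `t • B`, provided `ν` is divided by `t²`
(`IsTheta0.dilate`, `IsTheta1.dilate`). Curl energies and volumes gain the Jacobian `t³`, the
integral over `B` in `𝓘` gains `t⁵`, and the surplus `t²` is the change of `ν`. With `t = sα/α'` the
two values of `ν` match, and the prefactor `(α' t)³ = s³ α³` gives the claim (`IsMPT.scale`).
Uniqueness: arbitrary solutions are allowed on both sides, so the tensor must not depend on them
(`IsMPT.unique`). The fields themselves need not be shown unique, only their curls and, if `ν ≠ 0`,
`θ_i^{(0)} + θ_i^{(1)}` in `B`. The difference `W` of two solutions is tested with `χ² W`. The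
Caccioppoli inequality (`caccioppoli`) and `W = O(|ξ|⁻¹)` bound the curl energy in a ball by `R⁻² ·
R⁻² · R³ = R⁻¹` up to a constant, so the curl vanishes (`weakCurl_ae_eq_zero_of_decay`). For
`θ_i^{(1)}` the extra term `iν ∫_B χ²|W|²` is purely imaginary: it drops out of the real part, and
once the curl is zero it forces `W = 0` in `B`. -/

theorem MemL2Loc.locallyIntegrable {u : V3 ℝ → V3 𝕜} (hu : MemL2Loc u) :
    LocallyIntegrable u volume := by
  rw [locallyIntegrable_iff]
  intro K hK
  have : IsFiniteMeasure (volume.restrict K) := ⟨by simpa using hK.measure_lt_top⟩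
  exact (hu K hK).integrable one_le_two

theorem MemL2Loc.aestronglyMeasurable {u : V3 ℝ → V3 𝕜} (hu : MemL2Loc u) :
    AEStronglyMeasurable u volume :=
  hu.locallyIntegrable.aestronglyMeasurable

theorem MemL2Loc.locallyIntegrable_apply {u : V3 ℝ → V3 𝕜} (hu : MemL2Loc u) (k : Fin 3) :
    LocallyIntegrable (fun x => u x k) volume := by
  rw [locallyIntegrable_iff]
  intro K hK
  have h := (locallyIntegrable_iff.1 hu.locallyIntegrable) K hK
  exact Integrable.mono h ((EuclideanSpace.proj (𝕜 := 𝕜) k).continuous.comp_aestronglyMeasurable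
    h.aestronglyMeasurable) (Filter.Eventually.of_forall fun x => PiLp.norm_apply_le (u x) k)

theorem MemL2Loc.locallyIntegrable_norm_sq {u : V3 ℝ → V3 𝕜} (hu : MemL2Loc u) :
    LocallyIntegrable (fun x => ‖u x‖ ^ 2) volume := by
  rw [locallyIntegrable_iff]
  intro K hK
  exact (hu K hK).integrable_norm_pow two_ne_zero

theorem MemL2Loc.add {u v : V3 ℝ → V3 𝕜} (hu : MemL2Loc u) (hv : MemL2Loc v) :
    MemL2Loc (u + v) := fun K hK => (hu K hK).add (hv K hK)

theorem MemL2Loc.sub {u v : V3 ℝ → V3 𝕜} (hu : MemL2Loc u) (hv : MemL2Loc v) :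
    MemL2Loc (u - v) := fun K hK => (hu K hK).sub (hv K hK)

theorem MemL2Loc.of_continuous_bound {u v : V3 ℝ → V3 𝕜} (hu : MemL2Loc u)
    (hv : AEStronglyMeasurable v volume) {f : V3 ℝ → ℝ} (hf : Continuous f)
    (h : ∀ x, ‖v x‖ ≤ f x * ‖u x‖) : MemL2Loc v := by
  intro K hK
  obtain ⟨C, hC⟩ := hK.exists_bound_of_continuousOn hf.continuousOn
  refine (hu K hK).of_le_mul (c := C) hv.restrict ?_
  refine (ae_restrict_of_forall_mem hK.measurableSet fun x hx => (h x).trans ?_)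
  gcongr
  exact (le_abs_self _).trans (hC x hx)

theorem MemL2Loc.of_continuous {u : V3 ℝ → V3 𝕜} (hu : Continuous u) : MemL2Loc u := by
  intro K hK
  have : IsFiniteMeasure (volume.restrict K) := ⟨by simpa using hK.measure_lt_top⟩
  obtain ⟨C, hC⟩ := hK.exists_bound_of_continuousOn hu.continuousOn
  exact MemLp.of_bound hu.aestronglyMeasurable C
    (ae_restrict_of_forall_mem hK.measurableSet hC)

theorem MemL2Loc.smul {u : V3 ℝ → V3 𝕜} (hu : MemL2Loc u) {f : V3 ℝ → ℝ} (hf : Continuous f) :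
    MemL2Loc (fun x => f x • u x) :=
  hu.of_continuous_bound (hf.aestronglyMeasurable.smul hu.aestronglyMeasurable) hf.norm
    fun _ => (norm_smul _ _).le

/-! ### The weak curl -/

theorem norm_e (k : Fin 3) : ‖e k‖ = 1 := by simp [e]

theorem continuous_curl_apply {φ : V3 ℝ → V3 ℝ} (hφ : ContDiff ℝ (⊤ : ℕ∞) φ) (k : Fin 3) :
    Continuous fun x => curl φ x k := by
  have h : Continuous (fderiv ℝ φ) := hφ.continuous_fderiv (by simp)
  simp only [curl]
  fun_prop

theorem hasCompactSupport_curl_apply {φ : V3 ℝ → V3 ℝ} (hφ : HasCompactSupport φ) (k : Fin 3) :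
    HasCompactSupport fun x => curl φ x k := by
  have h := hφ.fderiv (𝕜 := ℝ)
  exact h.comp_left (g := fun L : V3 ℝ →L[ℝ] V3 ℝ => L (e (k + 1)) (k + 2) - L (e (k + 2)) (k + 1))
    (by simp)

theorem HasCompactSupport.apply {φ : V3 ℝ → V3 ℝ} (hφ : HasCompactSupport φ) (k : Fin 3) :
    HasCompactSupport fun x => φ x k :=
  hφ.comp_left (g := fun v : V3 ℝ => v k) (by simp)

theorem MemL2Loc.integrable_pairing {u : V3 ℝ → V3 𝕜} (hu : MemL2Loc u) {f : V3 ℝ → Fin 3 → ℝ}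
    (hf : ∀ k, Continuous fun x => f x k) (hf' : ∀ k, HasCompactSupport fun x => f x k) :
    Integrable (fun x => ∑ k, f x k • u x k) volume :=
  integrable_finsetSum _ fun k _ =>
    (hu.locallyIntegrable_apply k).integrable_smul_left_of_hasCompactSupport (hf k) (hf' k)

theorem MemL2Loc.integrable_curl_pairing {u : V3 ℝ → V3 𝕜} (hu : MemL2Loc u) {φ : V3 ℝ → V3 ℝ}
    (hφ : ContDiff ℝ (⊤ : ℕ∞) φ) (hc : HasCompactSupport φ) :
    Integrable (fun x => ∑ k, curl φ x k • u x k) volume :=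
  hu.integrable_pairing (continuous_curl_apply hφ) (hasCompactSupport_curl_apply hc)

theorem MemL2Loc.integrable_test_pairing {u : V3 ℝ → V3 𝕜} (hu : MemL2Loc u) {φ : V3 ℝ → V3 ℝ}
    (hφ : Continuous φ) (hc : HasCompactSupport φ) :
    Integrable (fun x => ∑ k, φ x k • u x k) volume :=
  hu.integrable_pairing (fun k => by fun_prop) (HasCompactSupport.apply hc)

theorem IsWeakCurl.add {u v u' v' : V3 ℝ → V3 𝕜} (h : IsWeakCurl u v) (h' : IsWeakCurl u' v')
    (hu : MemL2Loc u) (hv : MemL2Loc v) (hu' : MemL2Loc u') (hv' : MemL2Loc v') :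
    IsWeakCurl (u + u') (v + v') := by
  intro φ hφ hc
  simp only [Pi.add_apply, PiLp.add_apply, smul_add, Finset.sum_add_distrib]
  rw [integral_add (hu.integrable_curl_pairing hφ hc) (hu'.integrable_curl_pairing hφ hc),
    integral_add (hv.integrable_test_pairing hφ.continuous hc)
      (hv'.integrable_test_pairing hφ.continuous hc), h φ hφ hc, h' φ hφ hc]

theorem IsWeakCurl.sub {u v u' v' : V3 ℝ → V3 𝕜} (h : IsWeakCurl u v) (h' : IsWeakCurl u' v')
    (hu : MemL2Loc u) (hv : MemL2Loc v) (hu' : MemL2Loc u') (hv' : MemL2Loc v') :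
    IsWeakCurl (u - u') (v - v') := by
  intro φ hφ hc
  simp only [Pi.sub_apply, PiLp.sub_apply, smul_sub, Finset.sum_sub_distrib]
  rw [integral_sub (hu.integrable_curl_pairing hφ hc) (hu'.integrable_curl_pairing hφ hc),
    integral_sub (hv.integrable_test_pairing hφ.continuous hc)
      (hv'.integrable_test_pairing hφ.continuous hc), h φ hφ hc, h' φ hφ hc]

theorem IsWeakCurl.congr_right {u v v' : V3 ℝ → V3 𝕜} (h : IsWeakCurl u v) (hv : v =ᵐ[volume] v') :
    IsWeakCurl u v' := by
  intro φ hφ hc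
  rw [h φ hφ hc]
  refine integral_congr_ae ?_
  filter_upwards [hv] with x hx
  rw [hx]

/-- The weak curl is unique up to null sets. -/
theorem IsWeakCurl.ae_unique {u v v' : V3 ℝ → V3 𝕜} (h : IsWeakCurl u v) (h' : IsWeakCurl u v')
    (hv : MemL2Loc v) (hv' : MemL2Loc v') : v =ᵐ[volume] v' := by
  have key : ∀ k : Fin 3, ∀ᵐ x ∂(volume : Measure (V3 ℝ)), v x k - v' x k = 0 := by
    intro k
    refine ae_eq_zero_of_integral_contDiff_smul_eq_zero
      ((hv.locallyIntegrable_apply k).sub (hv'.locallyIntegrable_apply k)) ?_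
    intro g hg hgc
    -- The test field `g e_k` isolates the component `k`, which reduces the claim to the scalar
    -- fundamental lemma of the calculus of variations.
    have hφ : ContDiff ℝ (⊤ : ℕ∞) fun x => g x • e k := hg.smul contDiff_const
    have hφc : HasCompactSupport fun x => g x • e k := hgc.smul_right
    have h1 := (h _ hφ hφc).symm.trans (h' _ hφ hφc)
    have hs : ∀ w : V3 ℝ → V3 𝕜, ∀ x, ∑ j, (g x • e k) j • w x j = g x • w x k := by
      intro w x
      rw [Finset.sum_eq_single k]
      · simp [e]
      · intro j _ hj
        simp [e, hj]
      · simp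
    simp only [hs] at h1
    simp only [smul_sub]
    rw [integral_sub, h1, sub_self]
    · exact (hv.locallyIntegrable_apply k).integrable_smul_left_of_hasCompactSupport
        hg.continuous hgc
    · exact (hv'.locallyIntegrable_apply k).integrable_smul_left_of_hasCompactSupport
        hg.continuous hgc
  filter_upwards [key 0, key 1, key 2] with x h0 h1 h2
  ext k
  fin_cases k
  · exact sub_eq_zero.1 h0
  · exact sub_eq_zero.1 h1
  · exact sub_eq_zero.1 h2

theorem MemHCurlLoc.weakCurl_spec {u : V3 ℝ → V3 𝕜} (hu : MemHCurlLoc u) :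
    MemL2Loc (weakCurl u) ∧ IsWeakCurl u (weakCurl u) := by
  have h := hu.2
  rw [weakCurl, dif_pos h]
  exact h.choose_spec

theorem IsWeakCurl.weakCurl_ae_eq {u v : V3 ℝ → V3 𝕜} (h : IsWeakCurl u v) (hv : MemL2Loc v) :
    weakCurl u =ᵐ[volume] v := by
  have hex : ∃ v : V3 ℝ → V3 𝕜, MemL2Loc v ∧ IsWeakCurl u v := ⟨v, hv, h⟩
  rw [weakCurl, dif_pos hex]
  exact hex.choose_spec.2.ae_unique h hex.choose_spec.1 hv

/-- With this default value, later identities between weak curls hold without knowing that the curls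
exist: either both fields have one, or both values are `0`. -/
theorem weakCurl_of_not_exists {u : V3 ℝ → V3 𝕜}
    (h : ¬∃ v : V3 ℝ → V3 𝕜, MemL2Loc v ∧ IsWeakCurl u v) : weakCurl u = 0 := by
  rw [weakCurl, dif_neg h]

theorem MemHCurlLoc.add {u v : V3 ℝ → V3 𝕜} (hu : MemHCurlLoc u) (hv : MemHCurlLoc v) :
    MemHCurlLoc (u + v) :=
  ⟨hu.1.add hv.1, _, hu.weakCurl_spec.1.add hv.weakCurl_spec.1,
    hu.weakCurl_spec.2.add hv.weakCurl_spec.2 hu.1 hu.weakCurl_spec.1 hv.1 hv.weakCurl_spec.1⟩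

theorem MemHCurlLoc.sub {u v : V3 ℝ → V3 𝕜} (hu : MemHCurlLoc u) (hv : MemHCurlLoc v) :
    MemHCurlLoc (u - v) :=
  ⟨hu.1.sub hv.1, _, hu.weakCurl_spec.1.sub hv.weakCurl_spec.1,
    hu.weakCurl_spec.2.sub hv.weakCurl_spec.2 hu.1 hu.weakCurl_spec.1 hv.1 hv.weakCurl_spec.1⟩

theorem MemHCurlLoc.weakCurl_add {u v : V3 ℝ → V3 𝕜} (hu : MemHCurlLoc u) (hv : MemHCurlLoc v) :
    weakCurl (u + v) =ᵐ[volume] weakCurl u + weakCurl v :=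
  (hu.weakCurl_spec.2.add hv.weakCurl_spec.2 hu.1 hu.weakCurl_spec.1 hv.1
    hv.weakCurl_spec.1).weakCurl_ae_eq (hu.weakCurl_spec.1.add hv.weakCurl_spec.1)

theorem MemHCurlLoc.weakCurl_sub {u v : V3 ℝ → V3 𝕜} (hu : MemHCurlLoc u) (hv : MemHCurlLoc v) :
    weakCurl (u - v) =ᵐ[volume] weakCurl u - weakCurl v :=
  (hu.weakCurl_spec.2.sub hv.weakCurl_spec.2 hu.1 hu.weakCurl_spec.1 hv.1
    hv.weakCurl_spec.1).weakCurl_ae_eq (hu.weakCurl_spec.1.sub hv.weakCurl_spec.1)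

/-- Adding a field with vanishing weak curl does not change the weak curl. -/
theorem weakCurl_ae_eq_of_sub {u u' : V3 ℝ → V3 𝕜} (hu : MemL2Loc u) (hu' : MemL2Loc u')
    (h : IsWeakCurl (u - u') 0) : weakCurl u =ᵐ[volume] weakCurl u' := by
  have h0 : MemL2Loc (0 : V3 ℝ → V3 𝕜) := MemL2Loc.of_continuous continuous_zero
  by_cases hex : ∃ v : V3 ℝ → V3 𝕜, MemL2Loc v ∧ IsWeakCurl u' v
  · obtain ⟨v, hv, hv'⟩ := hex
    have h1 := h.add hv' (hu.sub hu') h0 hu' hv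
    rw [sub_add_cancel, zero_add] at h1
    exact (h1.weakCurl_ae_eq hv).trans (hv'.weakCurl_ae_eq hv).symm
  · have hex' : ¬∃ v : V3 ℝ → V3 𝕜, MemL2Loc v ∧ IsWeakCurl u v := by
      rintro ⟨v, hv, hv'⟩
      refine hex ⟨v, hv, ?_⟩
      have h1 := hv'.sub h hu hv (hu.sub hu') h0
      rwa [sub_sub_cancel, sub_zero] at h1
    rw [weakCurl_of_not_exists hex, weakCurl_of_not_exists hex']

/-! ### Complexification -/

theorem continuous_toC : Continuous toC := by
  unfold toC
  fun_prop

theorem norm_toC (v : V3 ℝ) : ‖toC v‖ = ‖v‖ := by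
  simp [EuclideanSpace.norm_eq, toC]

theorem toC_sub (v w : V3 ℝ) : toC (v - w) = toC v - toC w := by
  ext k
  simp [toC]

theorem MemL2Loc.toC {u : V3 ℝ → V3 ℝ} (hu : MemL2Loc u) : MemL2Loc fun x => toC (u x) := by
  intro K hK
  exact (hu K hK).of_le (continuous_toC.comp_aestronglyMeasurable (hu K hK).1)
    (Filter.Eventually.of_forall fun _ => (norm_toC _).le)

theorem IsWeakCurl.toC {u v : V3 ℝ → V3 ℝ} (h : IsWeakCurl u v) :
    IsWeakCurl (fun x => toC (u x)) fun x => toC (v x) := by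
  intro φ hφ hc
  have key : ∀ (a : V3 ℝ → V3 ℝ) (w : V3 ℝ → V3 ℝ),
      ∫ x, ∑ k, a x k • (MPT.toC (w x)) k = ((∫ x, ∑ k, a x k • w x k : ℝ) : ℂ) := by
    intro a w
    rw [← integral_complex_ofReal]
    congr 1
    ext x
    simp [MPT.toC]
  rw [key, key, h φ hφ hc]

theorem MemHCurlLoc.toC {u : V3 ℝ → V3 ℝ} (hu : MemHCurlLoc u) :
    MemHCurlLoc fun x => toC (u x) :=
  ⟨hu.1.toC, _, hu.weakCurl_spec.1.toC, hu.weakCurl_spec.2.toC⟩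

/-! ### The product rule -/

/-- The cross product `g × u` of a gradient `g`, given as a linear form, with a vector `u`. -/
def gradCross (g : V3 ℝ →L[ℝ] ℝ) (u : V3 𝕜) : V3 𝕜 :=
  WithLp.toLp 2 fun k : Fin 3 => g (e (k + 1)) • u (k + 2) - g (e (k + 2)) • u (k + 1)

theorem continuous_gradCross :
    Continuous fun p : (V3 ℝ →L[ℝ] ℝ) × V3 𝕜 => gradCross p.1 p.2 := by
  unfold gradCross
  fun_prop

theorem gradCross_smul (c : ℝ) (g : V3 ℝ →L[ℝ] ℝ) (u : V3 𝕜) :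
    gradCross (c • g) u = c • gradCross g u := by
  ext k
  simp [gradCross, smul_sub, mul_smul]

/-- Antisymmetry of the triple product; it moves `∇χ ×` from the field to the test field in the weak
product rule. -/
theorem sum_smul_gradCross (g : V3 ℝ →L[ℝ] ℝ) (a : V3 ℝ) (u : V3 𝕜) :
    ∑ k, a k • gradCross g u k = -∑ k, gradCross g a k • u k := by
  have h3 : (1 : Fin 3) + 2 = 0 ∧ (2 : Fin 3) + 1 = 0 ∧ (2 : Fin 3) + 2 = 1 ∧
    (1 : Fin 3) + 1 = 2 := by decide
  simp only [Fin.sum_univ_three, gradCross, h3, zero_add, RCLike.real_smul_eq_coe_mul,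
    RCLike.ofReal_sub, RCLike.ofReal_mul, RCLike.ofReal_real_eq_id, id_eq]
  ring

theorem norm_gradCross_le (g : V3 ℝ →L[ℝ] ℝ) (u : V3 𝕜) :
    ‖gradCross g u‖ ≤ 4 * (‖g‖ * ‖u‖) := by
  have hk : ∀ k, ‖(gradCross g u) k‖ ≤ 2 * (‖g‖ * ‖u‖) := by
    intro k
    have h : ∀ i j : Fin 3, ‖g (e i) • u j‖ ≤ ‖g‖ * ‖u‖ := by
      intro i j
      rw [norm_smul]
      have := g.le_opNorm (e i)
      rw [norm_e, mul_one] at this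
      exact mul_le_mul this (PiLp.norm_apply_le u j) (norm_nonneg _) (norm_nonneg _)
    calc _ ≤ ‖g (e (k + 1)) • u (k + 2)‖ + ‖g (e (k + 2)) • u (k + 1)‖ := norm_sub_le _ _
      _ ≤ _ := by linarith [h (k + 1) (k + 2), h (k + 2) (k + 1)]
  have hg : 0 ≤ ‖g‖ * ‖u‖ := by positivity
  -- Three components of size at most `2‖g‖‖u‖` give a squared norm of at most `12 ≤ 4²` times
  -- `(‖g‖‖u‖)²`; a sharp constant is not needed.
  refine le_of_sq_le_sq ?_ (by positivity)
  rw [EuclideanSpace.norm_sq_eq, Fin.sum_univ_three]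
  have h0 := pow_le_pow_left₀ (norm_nonneg _) (hk 0) 2
  have h1 := pow_le_pow_left₀ (norm_nonneg _) (hk 1) 2
  have h2 := pow_le_pow_left₀ (norm_nonneg _) (hk 2) 2
  nlinarith

theorem curl_smul {χ : V3 ℝ → ℝ} {φ : V3 ℝ → V3 ℝ} {x : V3 ℝ} (hχ : DifferentiableAt ℝ χ x)
    (hφ : DifferentiableAt ℝ φ x) :
    curl (fun y => χ y • φ y) x = χ x • curl φ x + gradCross (fderiv ℝ χ x) (φ x) := by
  ext k
  simp only [curl, gradCross, fderiv_fun_smul hχ hφ]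
  simp
  ring

theorem MemL2Loc.smul_add_gradCross {u v : V3 ℝ → V3 𝕜} (hu : MemL2Loc u) (hv : MemL2Loc v)
    {χ : V3 ℝ → ℝ} (hχ : ContDiff ℝ (⊤ : ℕ∞) χ) :
    MemL2Loc fun x => χ x • v x + gradCross (fderiv ℝ χ x) (u x) := by
  have h : Continuous (fderiv ℝ χ) := hχ.continuous_fderiv (by simp)
  refine (hv.smul hχ.continuous).add (hu.of_continuous_bound (f := fun x => 4 * ‖fderiv ℝ χ x‖)
    ?_ (by fun_prop) fun x => ?_)
  · exact continuous_gradCross.comp_aestronglyMeasurable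
      (h.aestronglyMeasurable.prodMk hu.aestronglyMeasurable)
  · rw [mul_assoc]
    exact norm_gradCross_le _ _

theorem sum_curl_smul {χ : V3 ℝ → ℝ} {φ : V3 ℝ → V3 ℝ} {x : V3 ℝ} (hχ : DifferentiableAt ℝ χ x)
    (hφ : DifferentiableAt ℝ φ x) (u : V3 𝕜) :
    ∑ k, curl φ x k • (χ x • u) k = ∑ k, curl (fun y => χ y • φ y) x k • u k -
      ∑ k, gradCross (fderiv ℝ χ x) (φ x) k • u k := by
  rw [curl_smul hχ hφ, ← Finset.sum_sub_distrib]
  refine Finset.sum_congr rfl fun k _ => ?_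
  simp only [PiLp.add_apply, PiLp.smul_apply, smul_smul, add_smul, smul_eq_mul]
  rw [mul_comm, add_sub_cancel_right]

theorem sum_smul_add_gradCross (c : ℝ) (g : V3 ℝ →L[ℝ] ℝ) (a : V3 ℝ) (u v : V3 𝕜) :
    ∑ k, a k • (c • v + gradCross g u) k =
      ∑ k, (c • a) k • v k - ∑ k, gradCross g a k • u k := by
  rw [sub_eq_add_neg, ← sum_smul_gradCross, ← Finset.sum_add_distrib]
  refine Finset.sum_congr rfl fun k _ => ?_
  simp only [PiLp.add_apply, PiLp.smul_apply, smul_smul, smul_add, smul_eq_mul]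
  rw [mul_comm]

theorem continuous_gradCross_fderiv {χ : V3 ℝ → ℝ} (hχ : ContDiff ℝ (⊤ : ℕ∞) χ)
    {φ : V3 ℝ → V3 ℝ} (hφ : Continuous φ) :
    Continuous fun x => gradCross (fderiv ℝ χ x) (φ x) :=
  continuous_gradCross.comp ((hχ.continuous_fderiv (by simp)).prodMk hφ)

theorem hasCompactSupport_gradCross (g : V3 ℝ → V3 ℝ →L[ℝ] ℝ) {φ : V3 ℝ → V3 ℝ}
    (hφ : HasCompactSupport φ) : HasCompactSupport fun x => gradCross (g x) (φ x) := by
  refine hφ.mono fun x hx => ?_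
  contrapose! hx
  simp only [Function.mem_support, not_not] at hx ⊢
  ext k
  simp [gradCross, hx]

/-- The product rule `∇ × (χ u) = χ ∇ × u + ∇χ × u` for the weak curl. -/
theorem IsWeakCurl.smul {u v : V3 ℝ → V3 𝕜} (h : IsWeakCurl u v) (hu : MemL2Loc u)
    (hv : MemL2Loc v) {χ : V3 ℝ → ℝ} (hχ : ContDiff ℝ (⊤ : ℕ∞) χ) :
    IsWeakCurl (fun x => χ x • u x)
      fun x => χ x • v x + gradCross (fderiv ℝ χ x) (u x) := by
  intro φ hφ hc
  have hχφ : ContDiff ℝ (⊤ : ℕ∞) fun x => χ x • φ x := hχ.smul hφ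
  have hχφc : HasCompactSupport fun x => χ x • φ x :=
    hc.mono (Function.support_smul_subset_right χ φ)
  have hcr := continuous_gradCross_fderiv hχ hφ.continuous
  have hcrc := hasCompactSupport_gradCross (fderiv ℝ χ) hc
  -- Both sides reduce to the identity for the test field `χ φ`, minus the same correction `∫ (∇χ ×
  -- φ) · u`.
  have e1 : ∀ x, ∑ k, curl φ x k • (χ x • u x) k =
      ∑ k, curl (fun y => χ y • φ y) x k • u x k -
        ∑ k, gradCross (fderiv ℝ χ x) (φ x) k • u x k := fun x =>
    sum_curl_smul (hχ.differentiable (by simp) x) (hφ.differentiable (by simp) x) (u x)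
  simp only [e1, sum_smul_add_gradCross]
  rw [integral_sub (hu.integrable_curl_pairing hχφ hχφc) (hu.integrable_test_pairing hcr hcrc),
    integral_sub (hv.integrable_test_pairing hχφ.continuous hχφc)
      (hu.integrable_test_pairing hcr hcrc), h _ hχφ hχφc]

theorem MemHCurlLoc.smul {u : V3 ℝ → V3 𝕜} (hu : MemHCurlLoc u) {χ : V3 ℝ → ℝ}
    (hχ : ContDiff ℝ (⊤ : ℕ∞) χ) : MemHCurlLoc fun x => χ x • u x :=
  ⟨hu.1.smul hχ.continuous, _, hu.1.smul_add_gradCross hu.weakCurl_spec.1 hχ,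
    hu.weakCurl_spec.2.smul hu.1 hu.weakCurl_spec.1 hχ⟩

theorem MemHCurlLoc.weakCurl_smul {u : V3 ℝ → V3 𝕜} (hu : MemHCurlLoc u) {χ : V3 ℝ → ℝ}
    (hχ : ContDiff ℝ (⊤ : ℕ∞) χ) : weakCurl (fun x => χ x • u x) =ᵐ[volume]
      fun x => χ x • weakCurl u x + gradCross (fderiv ℝ χ x) (u x) :=
  (hu.weakCurl_spec.2.smul hu.1 hu.weakCurl_spec.1 hχ).weakCurl_ae_eq
    (hu.1.smul_add_gradCross hu.weakCurl_spec.1 hχ)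

/-! ### The Caccioppoli inequality -/

theorem integrable_inner_smul {w U : V3 ℝ → V3 𝕜} (hw : MemL2Loc w) (hU : MemL2Loc U)
    {η : V3 ℝ → ℝ} (hη : Continuous η) (hηc : HasCompactSupport η) :
    Integrable (fun x => inner 𝕜 (η x • w x) (U x)) volume := by
  have hint : Integrable (fun x => |η x| • (‖w x‖ ^ 2 + ‖U x‖ ^ 2)) volume :=
    (hw.locallyIntegrable_norm_sq.add hU.locallyIntegrable_norm_sq
      ).integrable_smul_left_of_hasCompactSupport hη.abs hηc.abs
  refine hint.mono' ((hη.aestronglyMeasurable.smul hw.aestronglyMeasurable).inner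
    hU.aestronglyMeasurable) (Filter.Eventually.of_forall fun x => ?_)
  calc _ ≤ ‖η x • w x‖ * ‖U x‖ := norm_inner_le_norm _ _
    _ = |η x| * (‖w x‖ * ‖U x‖) := by rw [norm_smul, Real.norm_eq_abs, mul_assoc]
    _ ≤ |η x| * (‖w x‖ ^ 2 + ‖U x‖ ^ 2) := by
      gcongr
      nlinarith [sq_nonneg (‖w x‖ - ‖U x‖), sq_nonneg (‖w x‖), sq_nonneg (‖U x‖)]

/-- Needed before weak equations are subtracted or real parts taken under the integral. Both terms
of `η ∇ × w + ∇η × w` are compactly supported multiples of locally square integrable fields. -/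
theorem integrable_inner_weakCurl_smul {w U : V3 ℝ → V3 𝕜} (hw : MemHCurlLoc w)
    (hU : MemL2Loc U) {η : V3 ℝ → ℝ} (hη : ContDiff ℝ (⊤ : ℕ∞) η) (hηc : HasCompactSupport η)
    {m : V3 ℝ → ℝ} (hm : Measurable m) {C : ℝ} (hmC : ∀ x, |m x| ≤ C) :
    Integrable (fun x => m x • inner 𝕜 (weakCurl (fun y => η y • w y) x) (U x)) volume := by
  have hg : Continuous (fderiv ℝ η) := hη.continuous_fderiv (by simp)
  have h1 : Integrable (fun x => inner 𝕜 (η x • weakCurl w x) (U x)) volume :=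
    integrable_inner_smul hw.weakCurl_spec.1 hU hη.continuous hηc
  have h2 : Integrable (fun x => inner 𝕜 (gradCross (fderiv ℝ η x) (w x)) (U x)) volume := by
    have hint : Integrable (fun x => (4 * ‖fderiv ℝ η x‖) • (‖w x‖ ^ 2 + ‖U x‖ ^ 2)) volume :=
      (hw.1.locallyIntegrable_norm_sq.add hU.locallyIntegrable_norm_sq
        ).integrable_smul_left_of_hasCompactSupport (by fun_prop)
        ((hηc.fderiv (𝕜 := ℝ)).norm.mul_left)
    refine hint.mono' (AEStronglyMeasurable.inner ?_ hU.aestronglyMeasurable)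
      (Filter.Eventually.of_forall fun x => ?_)
    · exact continuous_gradCross.comp_aestronglyMeasurable
        (hg.aestronglyMeasurable.prodMk hw.1.aestronglyMeasurable)
    · calc _ ≤ ‖gradCross (fderiv ℝ η x) (w x)‖ * ‖U x‖ := norm_inner_le_norm _ _
        _ ≤ (4 * (‖fderiv ℝ η x‖ * ‖w x‖)) * ‖U x‖ := by
          gcongr
          exact norm_gradCross_le _ _
        _ = (4 * ‖fderiv ℝ η x‖) * (‖w x‖ * ‖U x‖) := by ring
        _ ≤ (4 * ‖fderiv ℝ η x‖) * (‖w x‖ ^ 2 + ‖U x‖ ^ 2) := by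
          gcongr
          nlinarith [sq_nonneg (‖w x‖ - ‖U x‖), sq_nonneg (‖w x‖), sq_nonneg (‖U x‖)]
  have h3 : Integrable (fun x => inner 𝕜 (weakCurl (fun y => η y • w y) x) (U x)) volume := by
    refine (h1.add h2).congr ?_
    filter_upwards [hw.weakCurl_smul hη] with x hx
    rw [hx, inner_add_left]
    rfl
  exact h3.bdd_smul C hm.aestronglyMeasurable (Filter.Eventually.of_forall hmC)

/-- Young's inequality `2|a||c||V| ≤ a²|V|²/2 + 2|c|²` absorbs the cross term. It is used with `a =
χ`, `V = ∇ × W`, `c = ∇χ × W`, so that the first argument of the inner product is `∇ × (χ² W)`. -/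
theorem le_re_inner_sq_smul_add (a : ℝ) (V c : V3 𝕜) :
    1 / 2 * (a ^ 2 * ‖V‖ ^ 2) - 2 * ‖c‖ ^ 2 ≤
      RCLike.re (inner 𝕜 (a ^ 2 • V + (2 * a) • c) V) := by
  have h1 : RCLike.re (inner 𝕜 (a ^ 2 • V) V) = a ^ 2 * ‖V‖ ^ 2 := by
    rw [RCLike.real_smul_eq_coe_smul (K := 𝕜), inner_smul_left, RCLike.conj_ofReal, RCLike.re_ofReal_mul,
      inner_self_eq_norm_sq]
  have h2 : |RCLike.re (inner 𝕜 ((2 * a) • c) V)| ≤ 2 * |a| * ‖c‖ * ‖V‖ := by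
    refine (RCLike.abs_re_le_norm _).trans ((norm_inner_le_norm _ _).trans ?_)
    rw [norm_smul, Real.norm_eq_abs, abs_mul, abs_two]
  rw [inner_add_left, map_add, h1]
  have h3 := neg_le_of_abs_le h2
  have h4 : (|a| * ‖V‖) ^ 2 = a ^ 2 * ‖V‖ ^ 2 := by rw [mul_pow, sq_abs]
  nlinarith [sq_nonneg (|a| * ‖V‖ - 2 * ‖c‖)]

/-- The Caccioppoli inequality for the curl-curl operator. -/
theorem caccioppoli {W : V3 ℝ → V3 𝕜} (hW : MemHCurlLoc W) {m : V3 ℝ → ℝ} (hm : Measurable m)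
    {c C : ℝ} (hc : 0 < c) (hcm : ∀ x, c ≤ m x) (hmC : ∀ x, m x ≤ C) {χ : V3 ℝ → ℝ}
    (hχ : ContDiff ℝ (⊤ : ℕ∞) χ) (hχc : HasCompactSupport χ)
    (h : RCLike.re (∫ x, m x • inner 𝕜 (weakCurl (fun y => χ y ^ 2 • W y) x) (weakCurl W x)) = 0) :
    c * ∫ x, χ x ^ 2 * ‖weakCurl W x‖ ^ 2 ≤ 64 * C * ∫ x, ‖fderiv ℝ χ x‖ ^ 2 * ‖W x‖ ^ 2 := by
  have hg : Continuous (fderiv ℝ χ) := hχ.continuous_fderiv (by simp)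
  have hη : ContDiff ℝ (⊤ : ℕ∞) fun x => χ x ^ 2 := hχ.pow 2
  have hηc : HasCompactSupport fun x => χ x ^ 2 := hχc.comp_left (g := fun t => t ^ 2) (by simp)
  have hint := integrable_inner_weakCurl_smul hW hW.weakCurl_spec.1 hη hηc hm (C := C)
    fun x => by rw [abs_of_nonneg (hc.le.trans (hcm x))]; exact hmC x
  have hA : Integrable (fun x => χ x ^ 2 * ‖weakCurl W x‖ ^ 2) volume :=
    hW.weakCurl_spec.1.locallyIntegrable_norm_sq.integrable_smul_left_of_hasCompactSupport
      hη.continuous hηc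
  have hD : Integrable (fun x => ‖fderiv ℝ χ x‖ ^ 2 * ‖W x‖ ^ 2) volume :=
    hW.1.locallyIntegrable_norm_sq.integrable_smul_left_of_hasCompactSupport
      (by fun_prop) ((hχc.fderiv (𝕜 := ℝ)).comp_left (g := fun L => ‖L‖ ^ 2) (by simp))
  rw [← integral_re hint] at h
  -- The constant `32 = 2 · 4²` is Young's factor times the square of the constant in
  -- `norm_gradCross_le`. The lower bound on `m` serves the curl term, the upper bound the gradient
  -- term.
  have key : ∫ x, (c / 2 * (χ x ^ 2 * ‖weakCurl W x‖ ^ 2) -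
      32 * C * (‖fderiv ℝ χ x‖ ^ 2 * ‖W x‖ ^ 2)) ≤ 0 := by
    rw [← h]
    refine integral_mono_ae ((hA.const_mul _).sub (hD.const_mul _)) hint.re ?_
    filter_upwards [hW.weakCurl_smul hη] with x hx
    have hd : fderiv ℝ (fun y => χ y ^ 2) x = (2 * χ x) • fderiv ℝ χ x := by
      rw [fderiv_fun_pow 2 (hχ.differentiable (by simp) x)]
      simp
    rw [hx, hd, gradCross_smul, RCLike.smul_re]
    have h1 := le_re_inner_sq_smul_add (χ x) (weakCurl W x) (gradCross (fderiv ℝ χ x) (W x))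
    have h2 := pow_le_pow_left₀ (norm_nonneg _) (norm_gradCross_le (fderiv ℝ χ x) (W x)) 2
    have h3 : 0 ≤ χ x ^ 2 * ‖weakCurl W x‖ ^ 2 := by positivity
    have h4 : 0 ≤ ‖fderiv ℝ χ x‖ ^ 2 * ‖W x‖ ^ 2 := by positivity
    have hm0 := hc.le.trans (hcm x)
    calc _ ≤ m x / 2 * (χ x ^ 2 * ‖weakCurl W x‖ ^ 2) -
          32 * m x * (‖fderiv ℝ χ x‖ ^ 2 * ‖W x‖ ^ 2) := by
          have := mul_le_mul_of_nonneg_right (hcm x) h3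
          have := mul_le_mul_of_nonneg_right (hmC x) h4
          linarith
      _ = m x * (1 / 2 * (χ x ^ 2 * ‖weakCurl W x‖ ^ 2) -
          2 * (4 * (‖fderiv ℝ χ x‖ * ‖W x‖)) ^ 2) := by ring
      _ ≤ _ := by
          refine mul_le_mul_of_nonneg_left ?_ hm0
          linarith
  rw [integral_sub (hA.const_mul _) (hD.const_mul _), integral_const_mul, integral_const_mul] at key
  linarith

/-- Cut-off functions, equal to `1` on the ball of radius `R`, with gradient `O(R⁻¹)` supported in
the shell between the spheres of radii `R` and `2 R`. -/
theorem exists_cutoff : ∃ G : ℝ, ∀ R : ℝ, 0 < R → ∃ χ : V3 ℝ → ℝ, ContDiff ℝ (⊤ : ℕ∞) χ ∧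
    HasCompactSupport χ ∧ (∀ x, ‖x‖ ≤ R → χ x = 1) ∧ (∀ x, ‖fderiv ℝ χ x‖ ≤ G * R⁻¹) ∧
    (∀ x, ‖x‖ < R → fderiv ℝ χ x = 0) ∧ ∀ x, 2 * R < ‖x‖ → fderiv ℝ χ x = 0 := by
  let f : ContDiffBump (0 : V3 ℝ) := ⟨1, 2, one_pos, one_lt_two⟩
  have hf : ContDiff ℝ (⊤ : ℕ∞) f := f.contDiff
  have hfc : HasCompactSupport f := f.hasCompactSupport
  obtain ⟨G, hG⟩ := (hfc.fderiv (𝕜 := ℝ)).exists_bound_of_continuous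
    (hf.continuous_fderiv (by simp))
  refine ⟨G, fun R hR => ⟨fun x => f (R⁻¹ • x), hf.comp (contDiff_const_smul _),
    hfc.comp_smul (inv_ne_zero hR.ne'), ?_, ?_, ?_, ?_⟩⟩
  · intro x hx
    apply f.one_of_mem_closedBall
    rw [mem_closedBall_zero_iff, norm_smul, norm_inv, Real.norm_of_nonneg hR.le]
    exact (inv_mul_le_one₀ hR).2 hx
  · intro x
    rw [fderiv_comp_smul, norm_smul, norm_inv, Real.norm_of_nonneg hR.le, mul_comm]
    gcongr
    exact hG _
  · intro x hx
    have hev : (fun x => f (R⁻¹ • x)) =ᶠ[nhds x] fun _ => 1 := by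
      filter_upwards [(isOpen_lt continuous_norm continuous_const).mem_nhds hx] with y hy
      apply f.one_of_mem_closedBall
      rw [mem_closedBall_zero_iff, norm_smul, norm_inv, Real.norm_of_nonneg hR.le]
      exact (inv_mul_le_one₀ hR).2 (le_of_lt hy)
    rw [hev.fderiv_eq, fderiv_fun_const]
    rfl
  · intro x hx
    have hev : (fun x => f (R⁻¹ • x)) =ᶠ[nhds x] fun _ => 0 := by
      filter_upwards [(isOpen_lt continuous_const continuous_norm).mem_nhds hx] with y hy
      apply f.zero_of_le_dist
      rw [dist_zero_right, norm_smul, norm_inv, Real.norm_of_nonneg hR.le, inv_mul_eq_div,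
        le_div_iff₀ hR]
      exact le_of_lt hy
    rw [hev.fderiv_eq, fderiv_fun_const]
    rfl

/-- A decaying field satisfying the Caccioppoli identity for all cut-off functions has vanishing
weak curl. -/
theorem weakCurl_ae_eq_zero_of_decay {W : V3 ℝ → V3 𝕜} (hW : MemHCurlLoc W)
    (hd : DecaysAtInfinity W) {m : V3 ℝ → ℝ} (hm : Measurable m)
    {c C : ℝ} (hc : 0 < c) (hcm : ∀ x, c ≤ m x) (hmC : ∀ x, m x ≤ C)
    (h : ∀ χ : V3 ℝ → ℝ, ContDiff ℝ (⊤ : ℕ∞) χ → HasCompactSupport χ →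
      RCLike.re (∫ x, m x • inner 𝕜 (weakCurl (fun y => χ y ^ 2 • W y) x) (weakCurl W x)) = 0) :
    weakCurl W =ᵐ[volume] 0 := by
  obtain ⟨G, hG⟩ := exists_cutoff
  obtain ⟨D, R₀, hD⟩ := hd
  set v : ℝ := volume.real (Metric.closedBall (0 : V3 ℝ) 1) with hv
  set K : ℝ := c⁻¹ * (64 * C * (8 * v * (G ^ 2 * D ^ 2))) with hK
  have hC : 0 ≤ C := hc.le.trans ((hcm 0).trans (hmC 0))
  have hL2 := hW.weakCurl_spec.1.locallyIntegrable_norm_sq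
  -- The radius `r` stays fixed while `R` later tends to infinity.
  have bound : ∀ r R : ℝ, 0 < R → R₀ ≤ R → r ≤ R →
      ∫ x in Metric.closedBall (0 : V3 ℝ) r, ‖weakCurl W x‖ ^ 2 ≤ K * R⁻¹ := by
    intro r R hR hR₀ hr
    obtain ⟨χ, hχ, hχc, hχ1, hχG, hin, hout⟩ := hG R hR
    have h1 := caccioppoli hW hm hc hcm hmC hχ hχc (h χ hχ hχc)
    have hA : Integrable (fun x => χ x ^ 2 * ‖weakCurl W x‖ ^ 2) volume :=
      hL2.integrable_smul_left_of_hasCompactSupport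
        (hχ.pow 2).continuous (hχc.comp_left (g := fun t => t ^ 2) (by simp))
    have h2 : ∫ x in Metric.closedBall (0 : V3 ℝ) r, ‖weakCurl W x‖ ^ 2 ≤
        ∫ x, χ x ^ 2 * ‖weakCurl W x‖ ^ 2 := by
      calc _ = ∫ x in Metric.closedBall (0 : V3 ℝ) r, χ x ^ 2 * ‖weakCurl W x‖ ^ 2 := by
            refine setIntegral_congr_fun Metric.isClosed_closedBall.measurableSet fun x hx => ?_
            rw [hχ1 x ((mem_closedBall_zero_iff.1 hx).trans hr), one_pow, one_mul]
        _ ≤ _ := setIntegral_le_integral hA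
            (Filter.Eventually.of_forall fun x => by simp only [Pi.zero_apply]; positivity)
    have h3 : ∫ x, ‖fderiv ℝ χ x‖ ^ 2 * ‖W x‖ ^ 2 ≤ 8 * v * (G ^ 2 * D ^ 2) * R⁻¹ := by
      -- The decay of `W` is available only for `‖x‖ ≥ R`; inside, `∇χ` vanishes, so a constant
      -- majorant on the ball of radius `2R` suffices. Its volume contributes the factor `8 R³`.
      calc _ ≤ ∫ x, (Metric.closedBall (0 : V3 ℝ) (2 * R)).indicator
            (fun _ => (G * R⁻¹) ^ 2 * (D * R⁻¹) ^ 2) x := by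
            refine integral_mono_of_nonneg (Filter.Eventually.of_forall fun x => by
              simp only [Pi.zero_apply]; positivity) ?_ ?_
            · rw [integrable_indicator_iff Metric.isClosed_closedBall.measurableSet]
              exact integrableOn_const measure_closedBall_lt_top.ne
            · filter_upwards [hD] with x hx
              by_cases hx2 : ‖x‖ ≤ 2 * R
              · rw [Set.indicator_of_mem (mem_closedBall_zero_iff.2 hx2)]
                by_cases hx1 : ‖x‖ < R
                · rw [hin x hx1, norm_zero]
                  simp only [ne_eq, OfNat.ofNat_ne_zero, not_false_eq_true, zero_pow, zero_mul]
                  positivity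
                · rw [not_lt] at hx1
                  have hWx := hx (hR₀.trans hx1)
                  have hD0 : 0 ≤ D := by
                    have h5 : 0 < ‖x‖⁻¹ := inv_pos.2 (hR.trans_le hx1)
                    exact nonneg_of_mul_nonneg_left ((norm_nonneg _).trans hWx) h5
                  have hWx' : ‖W x‖ ≤ D * R⁻¹ := hWx.trans (by gcongr)
                  gcongr
                  exact hχG x
              · rw [Set.indicator_of_notMem (by rwa [mem_closedBall_zero_iff]),
                  hout x (not_le.1 hx2)]
                simp
        _ = volume.real (Metric.closedBall (0 : V3 ℝ) (2 * R)) *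
            ((G * R⁻¹) ^ 2 * (D * R⁻¹) ^ 2) := by
            rw [integral_indicator_const _ Metric.isClosed_closedBall.measurableSet, smul_eq_mul]
        _ = _ := by
            have : volume.real (Metric.closedBall (0 : V3 ℝ) (2 * R)) = (2 * R) ^ 3 * v := by
              rw [hv, Measure.real, Measure.real, Measure.addHaar_closedBall' _ _ (by positivity),
                ENNReal.toReal_mul, ENNReal.toReal_ofReal (by positivity)]
              simp
            rw [this]
            field_simp
            ring
    calc _ ≤ _ := h2
      _ ≤ c⁻¹ * (64 * C * ∫ x, ‖fderiv ℝ χ x‖ ^ 2 * ‖W x‖ ^ 2) := by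
          rw [le_inv_mul_iff₀ hc]
          exact h1
      _ ≤ c⁻¹ * (64 * C * (8 * v * (G ^ 2 * D ^ 2) * R⁻¹)) := by gcongr
      _ = _ := by rw [hK]; ring
  have hzero : ∀ n : ℕ, ∀ᵐ x ∂(volume : Measure (V3 ℝ)),
      x ∈ Metric.closedBall (0 : V3 ℝ) n → weakCurl W x = 0 := by
    intro n
    have hle : ∫ x in Metric.closedBall (0 : V3 ℝ) n, ‖weakCurl W x‖ ^ 2 ≤ 0 := by
      have ht : Filter.Tendsto (fun R : ℝ => K * R⁻¹) Filter.atTop (nhds 0) := by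
        simpa using tendsto_inv_atTop_zero.const_mul K
      refine ge_of_tendsto ht ?_
      filter_upwards [Filter.eventually_gt_atTop 0, Filter.eventually_ge_atTop R₀,
        Filter.eventually_ge_atTop (n : ℝ)] with R h1 h2 h3
      exact bound n R h1 h2 h3
    have h0 : 0 ≤ᵐ[volume.restrict (Metric.closedBall (0 : V3 ℝ) n)]
        fun x => ‖weakCurl W x‖ ^ 2 :=
      Filter.Eventually.of_forall fun x => by simp only [Pi.zero_apply]; positivity
    have hi := (locallyIntegrable_iff.1 hL2) _ (isCompact_closedBall (0 : V3 ℝ) n)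
    have h2 := (setIntegral_eq_zero_iff_of_nonneg_ae h0 hi).1
      (le_antisymm hle (integral_nonneg_of_ae h0))
    rw [Filter.EventuallyEq, ae_restrict_iff' Metric.isClosed_closedBall.measurableSet] at h2
    filter_upwards [h2] with x hx hxn
    simpa using hx hxn
  filter_upwards [ae_all_iff.2 hzero] with x hx
  obtain ⟨n, hn⟩ := exists_nat_ge ‖x‖
  exact hx n (mem_closedBall_zero_iff.2 hn)

/-! ### Uniqueness of the fields entering the tensor -/

theorem DecaysAtInfinity.add {u v : V3 ℝ → V3 𝕜} (hu : DecaysAtInfinity u)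
    (hv : DecaysAtInfinity v) : DecaysAtInfinity (u + v) := by
  obtain ⟨C, R, h⟩ := hu
  obtain ⟨C', R', h'⟩ := hv
  refine ⟨C + C', max R R', ?_⟩
  filter_upwards [h, h'] with x hx hx' hR
  rw [add_mul]
  exact (norm_add_le _ _).trans
    (add_le_add (hx ((le_max_left _ _).trans hR)) (hx' ((le_max_right _ _).trans hR)))

theorem DecaysAtInfinity.sub {u v : V3 ℝ → V3 𝕜} (hu : DecaysAtInfinity u)
    (hv : DecaysAtInfinity v) : DecaysAtInfinity (u - v) := by
  obtain ⟨C, R, h⟩ := hv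
  rw [sub_eq_add_neg]
  exact hu.add ⟨C, R, by simpa using h⟩

theorem DecaysAtInfinity.toC {u : V3 ℝ → V3 ℝ} (hu : DecaysAtInfinity u) :
    DecaysAtInfinity fun x => toC (u x) := by
  obtain ⟨C, R, h⟩ := hu
  exact ⟨C, R, by simpa only [norm_toC] using h⟩

theorem measurable_inv_muTilde {B : Set (V3 ℝ)} (hB : MeasurableSet B) (μr : ℝ) :
    Measurable fun x => (muTilde B μr x)⁻¹ := by
  unfold muTilde
  exact (Measurable.ite hB measurable_const measurable_const).inv

theorem min_le_inv_muTilde (B : Set (V3 ℝ)) (μr : ℝ) (x : V3 ℝ) :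
    min μr⁻¹ 1 ≤ (muTilde B μr x)⁻¹ := by
  unfold muTilde
  split_ifs <;> simp

theorem inv_muTilde_le_max (B : Set (V3 ℝ)) (μr : ℝ) (x : V3 ℝ) :
    (muTilde B μr x)⁻¹ ≤ max μr⁻¹ 1 := by
  unfold muTilde
  split_ifs <;> simp

theorem abs_inv_muTilde_le (B : Set (V3 ℝ)) {μr : ℝ} (hμ : 0 < μr) (x : V3 ℝ) :
    |(muTilde B μr x)⁻¹| ≤ max μr⁻¹ 1 := by
  rw [abs_of_nonneg ((le_min (inv_pos.2 hμ).le zero_le_one).trans (min_le_inv_muTilde B μr x))]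
  exact inv_muTilde_le_max B μr x

theorem continuous_eCross (i : Fin 3) : Continuous (eCross i) := by
  unfold eCross
  simp only [crossProduct, LinearMap.mk₂_apply]
  fun_prop

theorem hasCompactSupport_sq_smul {χ : V3 ℝ → ℝ} (hχ : HasCompactSupport χ) (W : V3 ℝ → V3 𝕜) :
    HasCompactSupport fun x => χ x ^ 2 • W x :=
  hχ.mono fun x hx => by
    contrapose! hx
    simp only [Function.mem_support, not_not] at hx ⊢
    simp [hx]

/-- Two solutions `θ_i^{(0)}` have the same curl. -/
theorem IsTheta0.isWeakCurl_sub {B : Set (V3 ℝ)} (hB : MeasurableSet B) {μr : ℝ} (hμ : 0 < μr)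
    {i : Fin 3} {θ θ' : V3 ℝ → V3 ℝ} (h : IsTheta0 B μr i θ) (h' : IsTheta0 B μr i θ') :
    IsWeakCurl (θ - θ') 0 := by
  have hw := h.memHCurlLoc.sub h'.memHCurlLoc
  have hd : DecaysAtInfinity (θ - θ') := by
    have := h.decay.sub h'.decay
    convert this using 1
    ext1 x
    simp
  refine hw.weakCurl_spec.2.congr_right (weakCurl_ae_eq_zero_of_decay hw hd
    (measurable_inv_muTilde hB μr) (lt_min (inv_pos.2 hμ) one_pos) (min_le_inv_muTilde B μr)
    (inv_muTilde_le_max B μr) fun χ hχ hχc => ?_)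
  have hη : ContDiff ℝ (⊤ : ℕ∞) fun x => χ x ^ 2 := hχ.pow 2
  have hηc : HasCompactSupport fun x => χ x ^ 2 := hχc.comp_left (g := fun t => t ^ 2) (by simp)
  have hi : ∀ {U : V3 ℝ → V3 ℝ}, MemL2Loc U → _ := fun {U} hU =>
    integrable_inner_weakCurl_smul hw hU hη hηc (measurable_inv_muTilde hB μr)
      (abs_inv_muTilde_le B hμ)
  have e1 := h.weak_eq _ (hw.smul hη) (hasCompactSupport_sq_smul hχc _)
  have e2 := h'.weak_eq _ (hw.smul hη) (hasCompactSupport_sq_smul hχc _)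
  -- The right-hand side is read as `0 - 0`, and each zero is replaced by the weak equation of one
  -- of the two solutions.
  rw [RCLike.re_to_real, ← sub_zero (0 : ℝ)]
  nth_rewrite 1 [← e1]
  rw [← e2]
  refine Eq.trans ?_ (integral_sub (hi h.memHCurlLoc.weakCurl_spec.1)
    (hi h'.memHCurlLoc.weakCurl_spec.1))
  refine integral_congr_ae ?_
  filter_upwards [h.memHCurlLoc.weakCurl_sub h'.memHCurlLoc] with x hx
  rw [hx, Pi.sub_apply, inner_sub_right, smul_sub]
  rfl

theorem weakCurl_thetaTilde_ae_eq {B : Set (V3 ℝ)} (hB : MeasurableSet B) {μr : ℝ} (hμ : 0 < μr)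
    {θ0 θ0' : Fin 3 → V3 ℝ → V3 ℝ} (i : Fin 3) (h : IsTheta0 B μr i (θ0 i))
    (h' : IsTheta0 B μr i (θ0' i)) :
    weakCurl (thetaTilde θ0 i) =ᵐ[volume] weakCurl (thetaTilde θ0' i) := by
  have hc := MemL2Loc.of_continuous (continuous_eCross i)
  -- The field `e_i × ξ` cancels in the difference, so its curl need not be computed.
  refine weakCurl_ae_eq_of_sub (h.memHCurlLoc.1.sub hc) (h'.memHCurlLoc.1.sub hc) ?_
  convert h.isWeakCurl_sub hB hμ h' using 1
  ext1 x
  simp [thetaTilde]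

/-- Two solutions `θ_i^{(1)}`, possibly for different `θ_i^{(0)}`, have the same curl; if `ν ≠ 0`,
then moreover `θ_i^{(0)} + θ_i^{(1)}` is determined in `B`. -/
theorem IsTheta1.unique {B : Set (V3 ℝ)} (hB : MeasurableSet B) (hBb : Bornology.IsBounded B)
    {μr ν : ℝ} (hμ : 0 < μr) {i : Fin 3} {θ0 θ0' : V3 ℝ → V3 ℝ} {θ1 θ1' : V3 ℝ → V3 ℂ}
    (h0 : IsTheta0 B μr i θ0) (h0' : IsTheta0 B μr i θ0') (h1 : IsTheta1 B μr ν θ0 θ1)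
    (h1' : IsTheta1 B μr ν θ0' θ1') :
    weakCurl θ1 =ᵐ[volume] weakCurl θ1' ∧
      (ν ≠ 0 → ∀ᵐ x ∂volume.restrict B, θ1 x + toC (θ0 x) = θ1' x + toC (θ0' x)) := by
  set w0 : V3 ℝ → V3 ℂ := fun x => toC ((θ0 - θ0') x) with hw0
  -- Including `w0` makes `W` exactly the difference of the sources `θ0 + θ1`, while its curl is
  -- still that of `θ1 - θ1'` because `w0` is curl-free.
  set W : V3 ℝ → V3 ℂ := w0 + (θ1 - θ1') with hW
  have hm0 : MemHCurlLoc w0 := (h0.memHCurlLoc.sub h0'.memHCurlLoc).toC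
  have hm1 := h1.memHCurlLoc.sub h1'.memHCurlLoc
  have hmW : MemHCurlLoc W := hm0.add hm1
  have hd : DecaysAtInfinity W := by
    have hd0 : DecaysAtInfinity (θ0 - θ0') := by
      have := h0.decay.sub h0'.decay
      convert this using 1
      ext1 x
      simp
    exact hd0.toC.add (h1.decay.sub h1'.decay)
  have hcurl0 : weakCurl w0 =ᵐ[volume] 0 := by
    have h := (h0.isWeakCurl_sub hB hμ h0').toC
    have hz : (fun x : V3 ℝ => toC ((0 : V3 ℝ → V3 ℝ) x)) = 0 := by
      ext x k
      simp [toC]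
    rw [hz] at h
    exact h.weakCurl_ae_eq (MemL2Loc.of_continuous continuous_zero)
  have hcurl : weakCurl W =ᵐ[volume] weakCurl θ1 - weakCurl θ1' := by
    filter_upwards [hm0.weakCurl_add hm1, h1.memHCurlLoc.weakCurl_sub h1'.memHCurlLoc, hcurl0]
      with x hx hx1 hx0
    rw [hx, Pi.add_apply, hx0, hx1, Pi.zero_apply, zero_add]
  have test : ∀ χ : V3 ℝ → ℝ, ContDiff ℝ (⊤ : ℕ∞) χ → HasCompactSupport χ →
      ∫ x, (muTilde B μr x)⁻¹ • inner ℂ (weakCurl (fun y => χ y ^ 2 • W y) x) (weakCurl W x) =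
        Complex.I * (ν : ℂ) * ((∫ x in B, χ x ^ 2 * ‖W x‖ ^ 2 : ℝ) : ℂ) := by
    intro χ hχ hχc
    have hη : ContDiff ℝ (⊤ : ℕ∞) fun x => χ x ^ 2 := hχ.pow 2
    have hηc : HasCompactSupport fun x => χ x ^ 2 :=
      hχc.comp_left (g := fun t => t ^ 2) (by simp)
    have hi : ∀ {U : V3 ℝ → V3 ℂ}, MemL2Loc U → _ := fun {U} hU =>
      integrable_inner_weakCurl_smul hmW hU hη hηc (measurable_inv_muTilde hB μr)
        (abs_inv_muTilde_le B hμ)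
    have e1 := h1.weak_eq _ (hmW.smul hη) (hasCompactSupport_sq_smul hχc _)
    have e2 := h1'.weak_eq _ (hmW.smul hη) (hasCompactSupport_sq_smul hχc _)
    simp only [← Complex.real_smul] at e1 e2
    have l1 : ∫ x, (muTilde B μr x)⁻¹ •
        inner ℂ (weakCurl (fun y => χ y ^ 2 • W y) x) (weakCurl W x) = _ :=
      Eq.trans (integral_congr_ae (by
        filter_upwards [hcurl] with x hx
        rw [hx, Pi.sub_apply, inner_sub_right, smul_sub]))
        (integral_sub (hi h1.memHCurlLoc.weakCurl_spec.1) (hi h1'.memHCurlLoc.weakCurl_spec.1))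
    have l2 : ((∫ x in B, χ x ^ 2 * ‖W x‖ ^ 2 : ℝ) : ℂ) = _ :=
      Eq.trans (by
        rw [← integral_complex_ofReal]
        refine integral_congr_ae (Filter.Eventually.of_forall fun x => ?_)
        have hx : W x = (toC (θ0 x) + θ1 x) - (toC (θ0' x) + θ1' x) := by
          simp only [hW, hw0, Pi.add_apply, Pi.sub_apply, toC_sub]
          abel
        change _ = inner ℂ (χ x ^ 2 • W x) (toC (θ0 x) + θ1 x) -
          inner ℂ (χ x ^ 2 • W x) (toC (θ0' x) + θ1' x)
        rw [← inner_sub_right, ← hx, RCLike.real_smul_eq_coe_smul (K := ℂ), inner_smul_left,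
          inner_self_eq_norm_sq_to_K]
        simp)
        (integral_sub
          (integrable_inner_smul hmW.1 (h0.memHCurlLoc.1.toC.add h1.memHCurlLoc.1)
            hη.continuous hηc).restrict
          (integrable_inner_smul hmW.1 (h0'.memHCurlLoc.1.toC.add h1'.memHCurlLoc.1)
            hη.continuous hηc).restrict)
    rw [l1, l2]
    simp only [Pi.add_apply]
    linear_combination e1 - e2
  have hWcurl : weakCurl W =ᵐ[volume] 0 := by
    refine weakCurl_ae_eq_zero_of_decay hmW hd
      (measurable_inv_muTilde hB μr) (lt_min (inv_pos.2 hμ) one_pos) (min_le_inv_muTilde B μr)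
      (inv_muTilde_le_max B μr) fun χ hχ hχc => ?_
    rw [test χ hχ hχc]
    simp
  refine ⟨?_, fun hν => ?_⟩
  · filter_upwards [hcurl, hWcurl] with x hx hx0
    rw [hx] at hx0
    exact sub_eq_zero.1 hx0
  · obtain ⟨R, hR, hBR⟩ := hBb.subset_closedBall_lt 0 0
    -- With `χ = 1` on `B` and `∇ × W = 0`, the tested identity becomes `ν ∫_B |W|² = 0`.
    obtain ⟨χ, hχ, hχc, hχ1, -⟩ := exists_cutoff.choose_spec R hR
    have hz := test χ hχ hχc
    have hl : ∫ x, (muTilde B μr x)⁻¹ •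
        inner ℂ (weakCurl (fun y => χ y ^ 2 • W y) x) (weakCurl W x) = 0 := by
      rw [← integral_zero (V3 ℝ) ℂ]
      refine integral_congr_ae ?_
      filter_upwards [hWcurl] with x hx
      rw [hx]
      simp
    rw [hl] at hz
    have hz' : ∫ x in B, χ x ^ 2 * ‖W x‖ ^ 2 = 0 := by
      simpa [hν] using hz.symm
    have hint : Integrable (fun x => χ x ^ 2 * ‖W x‖ ^ 2) volume :=
      hmW.1.locallyIntegrable_norm_sq.integrable_smul_left_of_hasCompactSupport
        (hχ.pow 2).continuous (hχc.comp_left (g := fun t => t ^ 2) (by simp))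
    have hae := (setIntegral_eq_zero_iff_of_nonneg_ae (Filter.Eventually.of_forall fun x => by
      simp only [Pi.zero_apply]; positivity) hint.integrableOn).1 hz'
    filter_upwards [hae, ae_restrict_mem hB] with x hx hxB
    rw [hχ1 x (mem_closedBall_zero_iff.1 (hBR hxB))] at hx
    have hWx : W x = 0 := by simpa using hx
    have hx' : W x = (θ1 x + toC (θ0 x)) - (θ1' x + toC (θ0' x)) := by
      simp only [hW, hw0, Pi.add_apply, Pi.sub_apply, toC_sub]
      abel
    exact sub_eq_zero.1 (hx' ▸ hWx)

/-- The tensor does not depend on the solutions from which it is computed. -/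
theorem IsMPT.unique {B : Set (V3 ℝ)} (hB : MeasurableSet B) (hBb : Bornology.IsBounded B)
    {α ω μr σ : ℝ} (hμ : 0 < μr) {M M' : Matrix (Fin 3) (Fin 3) ℂ} (h : IsMPT α B ω μr σ M)
    (h' : IsMPT α B ω μr σ M') : M = M' := by
  obtain ⟨θ0, θ1, h0, h1, hM⟩ := h
  obtain ⟨θ0', θ1', h0', h1', hM'⟩ := h'
  have hN := fun i => weakCurl_thetaTilde_ae_eq hB hμ i (h0 i) (h0' i)
  have hU := fun i => (h1 i).unique hB hBb hμ (h0 i) (h0' i) (h1' i)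
  ext i j
  rw [hM, hM']
  congr 1
  · congr 1
    · congr 1
      unfold tensorN0
      congr 2
      refine integral_congr_ae ?_
      filter_upwards [hN i, hN j] with x hi hj
      rw [hi, hj]
    · unfold tensorR
      congr 1
      refine integral_congr_ae ?_
      filter_upwards [(hU i).1, (hU j).1] with x hi hj
      rw [hi, hj]
  · unfold tensorI
    congr 2
    -- For `ν = 0` the fields in `B` are not controlled, but `ν` is a factor of the integrand.
    by_cases hν : nu α ω σ = 0
    · simp [hν]
    · refine integral_congr_ae ?_
      filter_upwards [(hU i).2 hν, (hU j).2 hν] with x hi hj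
      simp only [thetaTilde, sub_add_cancel]
      rw [hi, hj]

/-! ### Dilations -/

/-- The dilation `ξ ↦ t u(ξ / t)` of a vector field `u`. -/
def dilate (t : ℝ) (u : V3 ℝ → V3 𝕜) (x : V3 ℝ) : V3 𝕜 := t • u (t⁻¹ • x)

theorem dilate_dilate_inv {t : ℝ} (ht : t ≠ 0) (u : V3 ℝ → V3 𝕜) :
    dilate t (dilate t⁻¹ u) = u := by
  ext1 x
  simp [dilate, smul_smul, ht]

theorem dilate_inv_dilate {t : ℝ} (ht : t ≠ 0) (u : V3 ℝ → V3 𝕜) :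
    dilate t⁻¹ (dilate t u) = u := by
  ext1 x
  simp [dilate, smul_smul, ht]

theorem ae_comp_inv_smul {t : ℝ} (ht : t ≠ 0) {p : V3 ℝ → Prop} (h : ∀ᵐ x, p x) :
    ∀ᵐ x, p (t⁻¹ • x) :=
  (Measure.quasiMeasurePreserving_smul volume (inv_ne_zero ht)).ae h

theorem integral_comp_inv_smul {F : Type*} [NormedAddCommGroup F] [NormedSpace ℝ F] {t : ℝ}
    (ht : 0 < t) (f : V3 ℝ → F) : ∫ x, f (t⁻¹ • x) = t ^ 3 • ∫ x, f x := by
  rw [Measure.integral_comp_inv_smul_of_nonneg _ _ ht.le]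
  simp

theorem setIntegral_comp_inv_smul {F : Type*} [NormedAddCommGroup F] [NormedSpace ℝ F] {t : ℝ}
    (ht : 0 < t) (B : Set (V3 ℝ)) (f : V3 ℝ → F) :
    ∫ x in t • B, f (t⁻¹ • x) = t ^ 3 • ∫ x in B, f x := by
  rw [Measure.setIntegral_comp_smul_of_pos _ _ _ (inv_pos.2 ht), inv_smul_smul₀ ht.ne']
  simp

theorem MemL2Loc.comp_inv_smul {u : V3 ℝ → V3 𝕜} (hu : MemL2Loc u) {t : ℝ} (ht : t ≠ 0) :
    MemL2Loc fun x => u (t⁻¹ • x) := by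
  intro K hK
  have ht' := inv_ne_zero ht
  have hemb : MeasurableEmbedding fun x : V3 ℝ => t⁻¹ • x :=
    (Homeomorph.smulOfNeZero t⁻¹ ht').measurableEmbedding
  have hpre : (fun x : V3 ℝ => t⁻¹ • x) ⁻¹' (t⁻¹ • K) = K := by
    ext x
    simp [Set.smul_mem_smul_set_iff₀ ht']
  have hmap : Measure.map (fun x : V3 ℝ => t⁻¹ • x) (volume.restrict K) =
      (ENNReal.ofReal |(t⁻¹ ^ Module.finrank ℝ (V3 ℝ))⁻¹| • volume).restrict (t⁻¹ • K) := by
    rw [← Measure.map_addHaar_smul volume ht', hemb.restrict_map, hpre]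
  refine (hemb.memLp_map_measure_iff (g := u)).1 ?_
  rw [hmap, Measure.restrict_smul]
  exact (hu _ (hK.smul t⁻¹)).smul_measure ENNReal.ofReal_ne_top

theorem MemL2Loc.dilate {u : V3 ℝ → V3 𝕜} (hu : MemL2Loc u) {t : ℝ} (ht : t ≠ 0) :
    MemL2Loc (dilate t u) :=
  (hu.comp_inv_smul ht).smul continuous_const

theorem curl_comp_smul (t : ℝ) (φ : V3 ℝ → V3 ℝ) (x : V3 ℝ) :
    curl (fun y => φ (t • y)) x = t • curl φ (t • x) := by
  ext k
  simp [curl, fderiv_comp_smul, mul_sub]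

/-- The amplitude `t` cancels the `t⁻¹` from differentiating `u(·/t)`, so no power of `t` remains in
the curl. -/
theorem IsWeakCurl.dilate {u v : V3 ℝ → V3 𝕜} (h : IsWeakCurl u v) {t : ℝ} (ht : 0 < t) :
    IsWeakCurl (dilate t u) fun x => v (t⁻¹ • x) := by
  intro φ hφ hc
  have h1 := h (fun y => φ (t • y)) (hφ.comp (contDiff_const_smul t)) (hc.comp_smul ht.ne')
  have e1 : ∀ x, ∑ k, curl φ x k • MPT.dilate t u x k =
      (fun y => ∑ k, curl (fun z => φ (t • z)) y k • u y k) (t⁻¹ • x) := by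
    intro x
    simp only [curl_comp_smul, smul_inv_smul₀ ht.ne', MPT.dilate, PiLp.smul_apply]
    refine Finset.sum_congr rfl fun k _ => ?_
    rw [smul_eq_mul, mul_comm, mul_smul]
  have e2 : ∀ x, ∑ k, φ x k • v (t⁻¹ • x) k =
      (fun y => ∑ k, φ (t • y) k • v y k) (t⁻¹ • x) := by
    intro x
    simp only [smul_inv_smul₀ ht.ne']
  refine (integral_congr_ae (Filter.Eventually.of_forall e1)).trans
    (Eq.trans ?_ (integral_congr_ae (Filter.Eventually.of_forall e2)).symm)
  refine (integral_comp_inv_smul ht fun y => ∑ k, curl (fun z => φ (t • z)) y k • u y k).trans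
    (Eq.trans ?_ (integral_comp_inv_smul ht fun y => ∑ k, φ (t • y) k • v y k).symm)
  rw [h1]

theorem MemHCurlLoc.dilate {u : V3 ℝ → V3 𝕜} (hu : MemHCurlLoc u) {t : ℝ} (ht : 0 < t) :
    MemHCurlLoc (dilate t u) :=
  ⟨hu.1.dilate ht.ne', _, hu.weakCurl_spec.1.comp_inv_smul ht.ne', hu.weakCurl_spec.2.dilate ht⟩

theorem weakCurl_dilate {t : ℝ} (ht : 0 < t) (u : V3 ℝ → V3 𝕜) :
    weakCurl (dilate t u) =ᵐ[volume] fun x => weakCurl u (t⁻¹ • x) := by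
  by_cases hex : ∃ v : V3 ℝ → V3 𝕜, MemL2Loc v ∧ IsWeakCurl u v
  · obtain ⟨v, hv, huv⟩ := hex
    refine ((huv.dilate ht).weakCurl_ae_eq (hv.comp_inv_smul ht.ne')).trans ?_
    exact (ae_comp_inv_smul ht.ne' (huv.weakCurl_ae_eq hv)).mono fun x hx => hx.symm
  -- A curl of the dilated field would give one of `u` by dilating back; hence both sides take the
  -- default value `0`.
  · have hex' : ¬∃ v : V3 ℝ → V3 𝕜, MemL2Loc v ∧ IsWeakCurl (dilate t u) v := by
      rintro ⟨v, hv, huv⟩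
      have h1 := huv.dilate (inv_pos.2 ht)
      rw [dilate_inv_dilate ht.ne'] at h1
      exact hex ⟨_, hv.comp_inv_smul (inv_ne_zero ht.ne'), h1⟩
    rw [weakCurl_of_not_exists hex, weakCurl_of_not_exists hex']
    rfl

theorem IsDivFreeOn.dilate {u : V3 ℝ → V3 𝕜} {U : Set (V3 ℝ)} (h : IsDivFreeOn u U) {t : ℝ}
    (ht : 0 < t) : IsDivFreeOn (dilate t u) (t • U) := by
  intro φ hφ hc hU
  have hs : tsupport (fun y => φ (t • y)) ⊆ U := by
    have h1 : tsupport (fun y => φ (t • y)) = (fun y : V3 ℝ => t • y) ⁻¹' tsupport φ :=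
      tsupport_comp_eq_preimage φ (Homeomorph.smulOfNeZero t ht.ne')
    rw [h1]
    intro y hy
    exact (Set.smul_mem_smul_set_iff₀ ht.ne' _ _).1 (hU hy)
  have h1 := h (fun y => φ (t • y)) (hφ.comp (contDiff_const_smul t)) (hc.comp_smul ht.ne') hs
  have e1 : ∀ x, ∑ k, fderiv ℝ φ x (e k) • MPT.dilate t u x k =
      (fun y => ∑ k, fderiv ℝ (fun z => φ (t • z)) y (e k) • u y k) (t⁻¹ • x) := by
    intro x
    simp only [fderiv_comp_smul, smul_inv_smul₀ ht.ne', MPT.dilate, PiLp.smul_apply,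
      smul_apply]
    refine Finset.sum_congr rfl fun k _ => ?_
    rw [smul_eq_mul, mul_comm, mul_smul]
  refine (integral_congr_ae (Filter.Eventually.of_forall e1)).trans
    ((integral_comp_inv_smul ht
      fun y => ∑ k, fderiv ℝ (fun z => φ (t • z)) y (e k) • u y k).trans ?_)
  rw [h1, smul_zero]

theorem DecaysAtInfinity.dilate {u : V3 ℝ → V3 𝕜} (h : DecaysAtInfinity u) {t : ℝ}
    (ht : 0 < t) : DecaysAtInfinity (dilate t u) := by
  obtain ⟨C, R, h⟩ := h
  -- One `t` is the amplitude, the other comes from `‖t⁻¹ x‖⁻¹ = t ‖x‖⁻¹`.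
  refine ⟨t * C * t, t * R, ?_⟩
  filter_upwards [ae_comp_inv_smul ht.ne' h] with x hx hR
  have hn : ‖t⁻¹ • x‖ = t⁻¹ * ‖x‖ := by
    rw [norm_smul, norm_inv, Real.norm_of_nonneg ht.le]
  rw [hn] at hx
  have h1 := hx ((le_inv_mul_iff₀ ht).2 hR)
  rw [MPT.dilate, norm_smul, Real.norm_of_nonneg ht.le]
  refine (mul_le_mul_of_nonneg_left h1 ht.le).trans_eq ?_
  rw [mul_inv, inv_inv]
  ring

theorem HasCompactSupport.dilate {u : V3 ℝ → V3 𝕜} (h : HasCompactSupport u) {t : ℝ}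
    (ht : t ≠ 0) : HasCompactSupport (dilate t u) :=
  (h.comp_smul (inv_ne_zero ht)).comp_left (g := fun v => t • v) (smul_zero t)

theorem muTilde_smul {t : ℝ} (ht : t ≠ 0) (B : Set (V3 ℝ)) (μr : ℝ) (x : V3 ℝ) :
    muTilde (t • B) μr x = muTilde B μr (t⁻¹ • x) := by
  have h := Set.mem_smul_set_iff_inv_smul_mem₀ ht B x
  unfold muTilde
  split_ifs with h1 h2 h2
  · rfl
  · exact absurd (h.1 h1) h2
  · exact absurd (h.2 h2) h1
  · rfl

theorem eCross_smul (i : Fin 3) (t : ℝ) (x : V3 ℝ) : eCross i (t • x) = t • eCross i x := by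
  simp [eCross]

theorem dilate_eCross {t : ℝ} (ht : t ≠ 0) (i : Fin 3) : dilate t (eCross i) = eCross i := by
  ext1 x
  rw [dilate, ← eCross_smul, smul_inv_smul₀ ht]

theorem dilate_sub (t : ℝ) (u v : V3 ℝ → V3 𝕜) (x : V3 ℝ) :
    dilate t (fun ξ => u ξ - v ξ) x = dilate t u x - dilate t v x := by
  simp [dilate, smul_sub]

theorem toC_smul (t : ℝ) (v : V3 ℝ) : toC (t • v) = t • toC v := by
  ext k
  simp [toC]

theorem inner_smul_smul_real (t : ℝ) (v w : V3 ℂ) :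
    inner ℂ (t • v) (t • w) = ((t ^ 2 : ℝ) : ℂ) * inner ℂ v w := by
  rw [RCLike.real_smul_eq_coe_smul (K := ℂ), RCLike.real_smul_eq_coe_smul (K := ℂ),
    inner_smul_left, inner_smul_right, RCLike.conj_ofReal]
  simp only [Complex.coe_algebraMap, Complex.ofReal_pow]
  ring

theorem smul_compl_frontier {t : ℝ} (ht : t ≠ 0) (B : Set (V3 ℝ)) :
    t • (frontier B)ᶜ = (frontier (t • B))ᶜ := by
  have h : t • frontier B = frontier (t • B) := (Homeomorph.smulOfNeZero t ht).image_frontier B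
  rw [← h]
  exact Set.image_compl_eq (Homeomorph.smulOfNeZero t ht).bijective

theorem smul_compl_closure {t : ℝ} (ht : t ≠ 0) (B : Set (V3 ℝ)) :
    t • (closure B)ᶜ = (closure (t • B))ᶜ := by
  have h : t • closure B = closure (t • B) := (Homeomorph.smulOfNeZero t ht).image_closure B
  rw [← h]
  exact Set.image_compl_eq (Homeomorph.smulOfNeZero t ht).bijective

/-- Change of variables in the energy of two dilated fields. -/
theorem integral_inner_weakCurl_dilate {t : ℝ} (ht : 0 < t) (B : Set (V3 ℝ)) (μr : ℝ)
    (u v : V3 ℝ → V3 𝕜) :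
    ∫ x, (muTilde (t • B) μr x)⁻¹ • inner 𝕜 (weakCurl (dilate t u) x) (weakCurl (dilate t v) x) =
      t ^ 3 • ∫ x, (muTilde B μr x)⁻¹ • inner 𝕜 (weakCurl u x) (weakCurl v x) := by
  rw [← integral_comp_inv_smul ht]
  refine integral_congr_ae ?_
  filter_upwards [weakCurl_dilate ht u, weakCurl_dilate ht v] with x hu hv
  rw [hu, hv, muTilde_smul ht.ne']

/-- The power `5` is `3` from the Jacobian and `2` from the two amplitudes. -/
theorem setIntegral_inner_dilate {t : ℝ} (ht : 0 < t) (B : Set (V3 ℝ)) (u v : V3 ℝ → V3 ℂ) :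
    ∫ x in t • B, inner ℂ (dilate t u x) (dilate t v x) =
      (t : ℂ) ^ 5 * ∫ x in B, inner ℂ (u x) (v x) := by
  have h := setIntegral_comp_inv_smul ht B fun x => inner ℂ (t • u x) (t • v x)
  simp only [inner_smul_smul_real, integral_const_mul] at h
  simp only [dilate, inner_smul_smul_real, integral_const_mul]
  rw [h, Complex.real_smul]
  push_cast
  ring

/-! ### Scaling of the solutions and of the tensor -/

/-- Every test field for `t • B` is the dilation of `dilate t⁻¹ ψ`, which is admissible for `B`; the
condition at infinity survives because `e_i × ξ` is homogeneous of degree one. -/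
theorem IsTheta0.dilate {B : Set (V3 ℝ)} {μr : ℝ} {i : Fin 3} {θ : V3 ℝ → V3 ℝ}
    (h : IsTheta0 B μr i θ) {t : ℝ} (ht : 0 < t) : IsTheta0 (t • B) μr i (dilate t θ) where
  memHCurlLoc := h.memHCurlLoc.dilate ht
  weak_eq ψ hψ hψc := by
    have h1 := h.weak_eq _ (hψ.dilate (inv_pos.2 ht))
      (HasCompactSupport.dilate hψc (inv_ne_zero ht.ne'))
    have h2 := integral_inner_weakCurl_dilate ht B μr (MPT.dilate t⁻¹ ψ) θ
    rw [dilate_dilate_inv ht.ne'] at h2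
    simp only [smul_eq_mul] at h2
    rw [h2, h1, mul_zero]
  div_free := smul_compl_frontier ht.ne' B ▸ h.div_free.dilate ht
  decay := by
    convert h.decay.dilate ht using 1
    ext1 x
    rw [dilate_sub, dilate_eCross ht.ne']

/-- The curl term scales by `t³` and the source by `t⁵`; the relation `ν' t² = ν` restores the
balance. -/
theorem IsTheta1.dilate {B : Set (V3 ℝ)} {μr ν ν' : ℝ} {θ0 : V3 ℝ → V3 ℝ} {θ : V3 ℝ → V3 ℂ}
    (h : IsTheta1 B μr ν θ0 θ) {t : ℝ} (ht : 0 < t) (hν : ν' * t ^ 2 = ν) :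
    IsTheta1 (t • B) μr ν' (dilate t θ0) (dilate t θ) where
  memHCurlLoc := h.memHCurlLoc.dilate ht
  weak_eq ψ hψ hψc := by
    have h1 := h.weak_eq _ (hψ.dilate (inv_pos.2 ht))
      (HasCompactSupport.dilate hψc (inv_ne_zero ht.ne'))
    have h2 := integral_inner_weakCurl_dilate ht B μr (MPT.dilate t⁻¹ ψ) θ
    have h3 := setIntegral_inner_dilate ht B (MPT.dilate t⁻¹ ψ) fun x => toC (θ0 x) + θ x
    have h4 : ∀ x, MPT.dilate t (fun x => toC (θ0 x) + θ x) x =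
        toC (MPT.dilate t θ0 x) + MPT.dilate t θ x := fun x => by
      simp [MPT.dilate, toC_smul]
    simp only [dilate_dilate_inv ht.ne', h4, Complex.real_smul] at h2 h3
    rw [h2, h3]
    have hν' : (ν : ℂ) = ν' * t ^ 2 := by rw [← hν]; push_cast; ring
    rw [hν'] at h1
    push_cast at h1 ⊢
    linear_combination (t : ℂ) ^ 3 * h1
  div_free := smul_compl_closure ht.ne' B ▸ h.div_free.dilate ht
  decay := h.decay.dilate ht

theorem thetaTilde_dilate {t : ℝ} (ht : t ≠ 0) (θ0 : Fin 3 → V3 ℝ → V3 ℝ) (i : Fin 3) :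
    thetaTilde (fun j => dilate t (θ0 j)) i = dilate t (thetaTilde θ0 i) := by
  ext1 x
  change _ = dilate t (fun ξ => θ0 i ξ - eCross i ξ) x
  rw [dilate_sub, dilate_eCross ht, thetaTilde]

theorem tensorN0_dilate {t : ℝ} (ht : 0 < t) (α : ℝ) (B : Set (V3 ℝ)) (μr : ℝ)
    (θ0 : Fin 3 → V3 ℝ → V3 ℝ) (i j : Fin 3) :
    tensorN0 α (t • B) μr (fun k => dilate t (θ0 k)) i j = tensorN0 (α * t) B μr θ0 i j := by
  have h1 := setIntegral_comp_inv_smul ht B fun _ => 1 - μr⁻¹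
  have h2 := integral_inner_weakCurl_dilate ht B μr (thetaTilde θ0 i) (thetaTilde θ0 j)
  simp only [smul_eq_mul] at h1 h2
  simp only [tensorN0, thetaTilde_dilate ht.ne']
  rw [h1, h2]
  ring

theorem tensorR_dilate {t : ℝ} (ht : 0 < t) (α : ℝ) (B : Set (V3 ℝ)) (μr : ℝ)
    (θ1 : Fin 3 → V3 ℝ → V3 ℂ) (i j : Fin 3) :
    tensorR α (t • B) μr (fun k => dilate t (θ1 k)) i j = tensorR (α * t) B μr θ1 i j := by
  have h2 := integral_inner_weakCurl_dilate ht B μr (θ1 i) (θ1 j)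
  simp only [Complex.real_smul] at h2
  simp only [tensorR]
  rw [h2]
  push_cast
  ring

/-- Of the factor `t⁵`, the part `t³` joins `α³` and the part `t²` joins `ν`. -/
theorem tensorI_dilate {t : ℝ} (ht : 0 < t) (α : ℝ) (B : Set (V3 ℝ)) (ν : ℝ)
    (θ0 : Fin 3 → V3 ℝ → V3 ℝ) (θ1 : Fin 3 → V3 ℝ → V3 ℂ) (i j : Fin 3) :
    tensorI α (t • B) ν (fun k => dilate t (θ0 k)) (fun k => dilate t (θ1 k)) i j =
      tensorI (α * t) B (ν * t ^ 2) θ0 θ1 i j := by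
  have h := setIntegral_inner_dilate ht B (fun x => θ1 i x + toC (θ0 i x))
    fun x => θ1 j x + toC (θ0 j x)
  have h4 : ∀ k x, dilate t (fun x => θ1 k x + toC (θ0 k x)) x =
      dilate t (θ1 k) x + toC (dilate t (θ0 k) x) := fun k x => by
    simp [dilate, toC_smul]
  simp only [h4] at h
  simp only [tensorI, thetaTilde, sub_add_cancel, integral_const_mul]
  rw [h]
  push_cast
  ring

theorem tensorN0_mul (s α : ℝ) (B : Set (V3 ℝ)) (μr : ℝ) (θ0 : Fin 3 → V3 ℝ → V3 ℝ)
    (i j : Fin 3) : tensorN0 (s * α) B μr θ0 i j = s ^ 3 * tensorN0 α B μr θ0 i j := by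
  simp only [tensorN0]
  ring

theorem tensorR_mul (s α : ℝ) (B : Set (V3 ℝ)) (μr : ℝ) (θ1 : Fin 3 → V3 ℝ → V3 ℂ)
    (i j : Fin 3) : tensorR (s * α) B μr θ1 i j = (s : ℂ) ^ 3 * tensorR α B μr θ1 i j := by
  simp only [tensorR]
  push_cast
  ring

/-- Here `ν` is held fixed; its own dependence on the size is compensated by the frequency `s² ω`.
-/
theorem tensorI_mul (s α : ℝ) (B : Set (V3 ℝ)) (ν : ℝ) (θ0 : Fin 3 → V3 ℝ → V3 ℝ)
    (θ1 : Fin 3 → V3 ℝ → V3 ℂ) (i j : Fin 3) :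
    tensorI (s * α) B ν θ0 θ1 i j = (s : ℂ) ^ 3 * tensorI α B ν θ0 θ1 i j := by
  simp only [tensorI]
  push_cast
  ring

theorem IsMPT.scale {α α' s t : ℝ} {B : Set (V3 ℝ)} {ω μr σ : ℝ} {M : Matrix (Fin 3) (Fin 3) ℂ}
    (ht : 0 < t) (hst : α' * t = s * α) (h : IsMPT α B (s ^ 2 * ω) μr σ M) :
    IsMPT α' (t • B) ω μr σ ((s : ℂ) ^ 3 • M) := by
  obtain ⟨θ0, θ1, h0, h1, hM⟩ := h
  have hν : nu α' ω σ * t ^ 2 = nu α (s ^ 2 * ω) σ := by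
    simp only [nu]
    -- Difference of squares: `(α' t)² - (s α)² = (α' t + s α)(α' t - s α)`.
    linear_combination ω * mu0 * σ * (α' * t + s * α) * hst
  refine ⟨fun i => dilate t (θ0 i), fun i => dilate t (θ1 i), fun i => (h0 i).dilate ht,
    fun i => (h1 i).dilate ht hν, fun i j => ?_⟩
  rw [tensorN0_dilate ht, tensorR_dilate ht, tensorI_dilate ht, hν, hst, tensorN0_mul,
    tensorR_mul, tensorI_mul, Matrix.smul_apply, hM, smul_eq_mul]
  push_cast
  ring

end MPT

end

/-- Object-size scaling of the magnetic polarizability tensor. The object `sαB` may be presented in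
any way as `α' B'`: with `α' = s α`, `B' = B`, with `α' = α`, `B' = s B`, or otherwise. Whatever
solutions of the transmission problems the two tensors are computed from, the tensor of `sαB` at
frequency `ω` is `s³` times that of `αB` at frequency `s² ω`, and each exists if the other does. -/
theorem mainTheorem3 (B B' : Set (MPT.V3 ℝ)) (hBo : IsOpen B) (hBb : Bornology.IsBounded B)
    (α α' s : ℝ) (hα : 0 < α) (hα' : 0 < α') (hs : 0 < s)
    (hB' : α' • B' = (s * α) • B)
    (μr : ℝ) (hμr : 0 < μr) (ω σ : ℝ) :
    (∀ M M' : Matrix (Fin 3) (Fin 3) ℂ,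
      MPT.IsMPT α B (s ^ 2 * ω) μr σ M → MPT.IsMPT α' B' ω μr σ M' →
        ∀ i j, M' i j = (s : ℂ) ^ 3 * M i j) ∧
    (∀ M : Matrix (Fin 3) (Fin 3) ℂ,
      MPT.IsMPT α B (s ^ 2 * ω) μr σ M ↔ MPT.IsMPT α' B' ω μr σ ((s : ℂ) ^ 3 • M)) := by
  have ht : 0 < s * α / α' := div_pos (mul_pos hs hα) hα'
  have hB't : B' = (s * α / α') • B := by
    rw [div_eq_inv_mul, mul_smul, ← hB', inv_smul_smul₀ hα'.ne']
  have hst : α' * (s * α / α') = s * α := mul_div_cancel₀ _ hα'.ne'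
  have hopen : IsOpen B' := hB't ▸ hBo.smul₀ ht.ne'
  have hbdd : Bornology.IsBounded B' := hB't ▸ hBb.smul₀ _
  have hfwd : ∀ M : Matrix (Fin 3) (Fin 3) ℂ, MPT.IsMPT α B (s ^ 2 * ω) μr σ M →
      MPT.IsMPT α' B' ω μr σ ((s : ℂ) ^ 3 • M) := fun M hM => by
    rw [hB't]
    exact hM.scale ht hst
  refine ⟨fun M M' hM hM' i j => ?_, fun M => ⟨hfwd M, fun hM => ?_⟩⟩
  · rw [hM'.unique hopen.measurableSet hbdd hμr (hfwd M hM), Matrix.smul_apply, smul_eq_mul]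
  -- The converse is the forward scaling with `s⁻¹` and `t⁻¹`, so `ω` is first written in the form
  -- `s⁻² · (s² ω)`.
  · have hω : s⁻¹ ^ 2 * (s ^ 2 * ω) = ω := by
      rw [← mul_assoc, ← mul_pow, inv_mul_cancel₀ hs.ne', one_pow, one_mul]
    rw [← hω] at hM
    have h := hM.scale (α' := α) (s := s⁻¹) (inv_pos.2 ht) (by field_simp)
    rw [hB't, inv_smul_smul₀ ht.ne', smul_smul, ← mul_pow, Complex.ofReal_inv,
      inv_mul_cancel₀ (Complex.ofReal_ne_zero.2 hs.ne'), one_pow, one_smul] at h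
    exact h
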